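/- \textbf{Setting.} Let $\mathsf X\subset\mathbb R$ and $\mathsf Y\subset\mathbb R^{q}$ be convex, $\mathsf Z=\mathsf X\times\mathsf Y$ with its Borel $\sigma$-algebra, $\Theta\subset\mathbb R^k$ and $\beta\in(0,1)$. For each $\theta\in\Theta$ let $r_\theta:\mathsf Z\to\mathbb R$ (exit payoff) and $c_\theta:\mathsf Y\to\mathbb R$ (flow continuation payoff) be measurable, and let $P_\theta$ be a stochastic kernel on $\mathsf Z$ of the form $P_\theta((x,y),\cdot)=\mathbb F^\theta_y$, i.e. the law of the next state $(x',y')$ depends on $y$ only. Write $c_\theta(x,y):=c_\theta(y)$. Let $(Z_t)_{t\ge 0}$ be the canonical Markov chain with kernel $P_\theta$, $\mathbb E^\theta_z$ the expectation when $Z_0=z$, and \[ v^*_\theta(z)=\sup_{\tau}\ \mathbb E^\theta_z\Big\{\sum_{t=0}^{\tau-1}\beta^t c_\theta(Z_t)+\beta^\tau r_\theta(Z_\tau)\Big\},\qquad \psi^*_\theta(y)=c_\theta(y)+\beta\int v^*_\theta(x',y')\,d\mathbb F^\theta_y(x',y'), \] the supremum being over almost surely finite stopping times $\tau$ of the filtration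 generated by $(Z_t)$. \textbf{Assumptions.} (1) (Drift.) For every $\theta$ there are a measurable $g_\theta:\mathsf Z\to[0,\infty)$, an integer $n_\theta\ge 0$ and reals $m_\theta,d_\theta\ge 0$ with $\beta m_\theta<1$ such that, for all $z\in\mathsf Z$, \[ \max\big\{\mathbb E^\theta_z|r_\theta(Z_{n_\theta})|,\ \mathbb E^\theta_z|c_\theta(Z_{n_\theta})|\big\}\le g_\theta(z) \quad\text{and}\quad \int g_\theta(z')P_\theta(z,dz')\le m_\theta g_\theta(z)+d_\theta . \] Moreover $n:=\sup_\theta n_\theta$, $m:=\sup_\theta m_\theta$ and $d:=\sup_\theta d_\theta$ are finite and $\beta m<1$. Fix $m',d'>0$ with $m+2m'>1$, $\beta(m+2m')<1$ and $d'\ge d/(m+2m'-1)$, and put \[ \ell(z,\theta):=m'\Big(\sum_{t=1}^{n-1}\mathbb E^\theta_z|r_\theta(Z_t)|+\sum_{t=0}^{n-1}\mathbb E^\theta_z|c_\theta(Z_t)|\Big)+g_\theta(z)+d'. \] (2) (Feller.) For every bounded continuous $h:\mathsf Z\to\mathbb R$ the map $(z,\theta)\mapsto\int h(z')P_\theta(z,dz')$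 is continuous. (3) (Continuity.) The maps $(z,\theta)\mapsto c_\theta(z)$, $r_\theta(z)$, $\ell(z,\theta)$, $\int|r_\theta(z')|P_\theta(z,dz')$ and $\int\ell(z',\theta)P_\theta(z,dz')$ are finite and continuous on $\mathsf Z\times\Theta$. (4) (Reservation threshold.) For every $\theta$, $r_\theta$ is strictly monotone in $x$ (either strictly increasing in $x$ for all $y$, or strictly decreasing in $x$ for all $y$), and for every $y\in\mathsf Y$ there is $x\in\mathsf X$ with $r_\theta(x,y)=\psi^*_\theta(y)$. \textbf{Conclusion.} For every $\theta$ there is a unique decision threshold $\bar x_\theta:\mathsf Y\to\mathsf X$, i.e. a function with $r_\theta(\bar x_\theta(y),y)=\psi^*_\theta(y)$ for all $y\in\mathsf Y$, and the map $(y,\theta)\mapsto\bar x_\theta(y)$ is continuous on $\mathsf Y\times\Theta$. -/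

import Mathlib

open MeasureTheory ProbabilityTheory
open scoped ENNReal NNReal BoundedContinuousFunction

noncomputable section

/-! ### Optimal stopping problems -/

/-- The primitives of an optimal timing problem on a measurable state space `Z`: a stochastic
kernel `P`, a measurable exit payoff `r` and a measurable flow continuation payoff `c`. -/
structure StoppingProblem (Z : Type*) [MeasurableSpace Z] where
  P : Kernel Z Z
  markov : IsMarkovKernel P
  r : Z → ℝ
  c : Z → ℝ
  measurable_r : Measurable r
  measurable_c : Measurable c

namespace StoppingProblem

variable {Z : Type*} [MeasurableSpace Z]

instance instMarkov (D : StoppingProblem Z) : IsMarkovKernel D.P := D.markov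

/-- The conditional law of `Z_{t+1}` given the history `(Z_0, …, Z_t)`; it depends on `Z_t` only. -/
def historyKernel (D : StoppingProblem Z) (t : ℕ) :
    Kernel ((i : Finset.Iic t) → (fun _ : ℕ => Z) i) Z :=
  D.P.comap (fun h => h ⟨t, Finset.mem_Iic.2 le_rfl⟩) (measurable_pi_apply _)

instance instMarkovHistory (D : StoppingProblem Z) (t : ℕ) :
    IsMarkovKernel (D.historyKernel t) := by
  unfold historyKernel; infer_instance

/-- `ℙ_z`: the law, on the canonical sequence space `ℕ → Z`, of the time-homogeneous Markov process
with stochastic kernel `P` started at `z`. The process itself is `Z_t(ω) = ω t`. -/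
def pathLaw (D : StoppingProblem Z) (z : Z) : Measure (ℕ → Z) :=
  Kernel.trajMeasure (X := fun _ : ℕ => Z) (Measure.dirac z) D.historyKernel

/-- The set of (almost surely finite) stopping times for the filtration generated by the
canonical process. -/
def stoppingTimes (D : StoppingProblem Z) : Set ((ℕ → Z) → WithTop ℕ) :=
  {τ | IsStoppingTime (Filtration.piLE (X := fun _ : ℕ => Z)) τ ∧
    ∀ z, ∀ᵐ ω ∂(D.pathLaw z), τ ω ≠ ⊤}

/-- The discounted payoff of stopping at time `k`:
`∑_{t < k} β ^ t c(Z_t) + β ^ k r(Z_k)`. -/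
def payoff (D : StoppingProblem Z) (β : ℝ) (ω : ℕ → Z) (k : ℕ) : ℝ :=
  (∑ t ∈ Finset.range k, β ^ t * D.c (ω t)) + β ^ k * D.r (ω k)

/-- The value function `v*`. (The default `0` in `untopD` is used on a null set only.) -/
def value (D : StoppingProblem Z) (β : ℝ) (z : Z) : ℝ :=
  sSup ((fun τ : (ℕ → Z) → WithTop ℕ => ∫ ω, D.payoff β ω ((τ ω).untopD 0) ∂(D.pathLaw z)) ''
    D.stoppingTimes)

/-- The continuation value function `ψ*(z) = c(z) + β ∫ v*(z') P(z, dz')`. -/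
def contValue (D : StoppingProblem Z) (β : ℝ) (z : Z) : ℝ :=
  D.c z + β * ∫ z', D.value β z' ∂(D.P z)

/-- `𝔼_z |h(Z_t)| = ∫ |h(z')| P^t(z, dz')`, a number in `[0, ∞]`. -/
def absMoment (D : StoppingProblem Z) (h : Z → ℝ) (t : ℕ) (z : Z) : ℝ≥0∞ :=
  ∫⁻ z', ENNReal.ofReal |h z'| ∂((D.P ^ t) z)

/-- The drift assumption, with function `g` and constants `n`, `m`, `d`. -/
structure Drift (D : StoppingProblem Z) (β : ℝ) (g : Z → ℝ≥0) (n : ℕ) (m d : ℝ≥0) : Prop where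
  measurable_g : Measurable g
  discount : β * m < 1
  exit_le : ∀ z, D.absMoment D.r n z ≤ g z
  flow_le : ∀ z, D.absMoment D.c n z ≤ g z
  drift : ∀ z, ∫⁻ z', (g z' : ℝ≥0∞) ∂(D.P z) ≤ (m : ℝ≥0∞) * g z + d

/-- The weight function
`ℓ(z) = m' (∑_{t=1}^{n-1} 𝔼_z |r(Z_t)| + ∑_{t=0}^{n-1} 𝔼_z |c(Z_t)|) + g(z) + d'`,
a number in `[0, ∞]`. -/
def weight (D : StoppingProblem Z) (g : Z → ℝ≥0) (n : ℕ) (m' d' : ℝ≥0) (z : Z) : ℝ≥0∞ :=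
  (m' : ℝ≥0∞) * ((∑ t ∈ Finset.Ico 1 n, D.absMoment D.r t z) +
    ∑ t ∈ Finset.range n, D.absMoment D.c t z) + g z + d'

end StoppingProblem

/-! ### Parametric families -/

/-- A `[0, ∞]`-valued function is everywhere finite, and continuous as a real function. -/
def FiniteContinuous {A : Type*} [TopologicalSpace A] (f : A → ℝ≥0∞) : Prop :=
  (∀ a, f a ≠ ∞) ∧ Continuous fun a => (f a).toReal

section Parametric

variable {Z Θ : Type*} [MeasurableSpace Z]

/-- The drift assumption holds at every parameter, and with `n = sup n_θ`, `m = sup m_θ`,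
`d = sup d_θ` one has `β m < 1` and `n, d < ∞`. -/
structure ParamDrift (D : Θ → StoppingProblem Z) (β : ℝ) (g : Θ → Z → ℝ≥0) (n : Θ → ℕ)
    (m d : Θ → ℝ≥0) : Prop where
  drift : ∀ θ, (D θ).Drift β (g θ) (n θ) (m θ) (d θ)
  bdd_n : BddAbove (Set.range n)
  bdd_m : BddAbove (Set.range m)
  bdd_d : BddAbove (Set.range d)
  discount : β * ((⨆ θ, m θ : ℝ≥0) : ℝ) < 1

/-- The admissible constants `m'` and `d'` in the definition of the weight function. -/
structure WeightConstants (β : ℝ) (m d m' d' : ℝ≥0) : Prop where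
  pos_m' : 0 < m'
  pos_d' : 0 < d'
  one_lt : 1 < (m : ℝ) + 2 * m'
  discount : β * ((m : ℝ) + 2 * m') < 1
  le_d' : (d : ℝ) / ((m : ℝ) + 2 * m' - 1) ≤ d'

/-- The parametric weight `ℓ(z, θ)`, built with `n = sup n_θ`. -/
def paramWeight (D : Θ → StoppingProblem Z) (g : Θ → Z → ℝ≥0) (n : Θ → ℕ) (m' d' : ℝ≥0)
    (z : Z) (θ : Θ) : ℝ≥0∞ :=
  (D θ).weight (g θ) (⨆ θ', n θ') m' d' z

variable [TopologicalSpace Z] [TopologicalSpace Θ]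

/-- The parametric Feller property. -/
def ParamFeller (D : Θ → StoppingProblem Z) : Prop :=
  ∀ h : Z →ᵇ ℝ, Continuous fun p : Z × Θ => ∫ z', h z' ∂((D p.2).P p.1)

/-- The parametric continuity assumption. -/
structure ParamCont (D : Θ → StoppingProblem Z) (g : Θ → Z → ℝ≥0) (n : Θ → ℕ)
    (m' d' : ℝ≥0) : Prop where
  cont_c : Continuous fun p : Z × Θ => (D p.2).c p.1
  cont_r : Continuous fun p : Z × Θ => (D p.2).r p.1
  cont_weight : FiniteContinuous fun p : Z × Θ => paramWeight D g n m' d' p.1 p.2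
  cont_int_r : FiniteContinuous fun p : Z × Θ =>
    ∫⁻ z', ENNReal.ofReal |(D p.2).r z'| ∂((D p.2).P p.1)
  cont_int_weight : FiniteContinuous fun p : Z × Θ =>
    ∫⁻ z', paramWeight D g n m' d' z' p.2 ∂((D p.2).P p.1)

end Parametric

/-! ### Threshold state problems -/

/-- A stopping problem on `X × Y` with conditionally independent transitions: the law `F y` of the
next state `(x', y')` depends on the current environment `y` only, and so does the flow
continuation payoff. -/
structure ThresholdProblem (X Y : Type*) [MeasurableSpace X] [MeasurableSpace Y] where
  F : Kernel Y (X × Y)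
  markov : IsMarkovKernel F
  r : X × Y → ℝ
  c : Y → ℝ
  measurable_r : Measurable r
  measurable_c : Measurable c

namespace ThresholdProblem

variable {X Y : Type*} [MeasurableSpace X] [MeasurableSpace Y]

/-- The underlying stopping problem, with `P((x, y), ·) = F_y`. -/
def toStopping (T : ThresholdProblem X Y) : StoppingProblem (X × Y) where
  P := T.F.comap Prod.snd measurable_snd
  markov := by
    have := T.markov
    infer_instance
  r := T.r
  c := fun z => T.c z.2
  measurable_r := T.measurable_r
  measurable_c := T.measurable_c.comp measurable_snd

/-- The continuation value as a function of the environment,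
`ψ*(y) = c(y) + β ∫ v*(x', y') dF_y(x', y')`. -/
def contValue (T : ThresholdProblem X Y) (β : ℝ) (y : Y) : ℝ :=
  T.c y + β * ∫ z', T.toStopping.value β z' ∂(T.F y)

theorem contValue_toStopping (T : ThresholdProblem X Y) (β : ℝ) (x : X) (y : Y) :
    T.toStopping.contValue β (x, y) = T.contValue β y := rfl

/-- The exit payoff is strictly monotone in the threshold state, and for every environment there
is a threshold state at which stopping and continuing are equally good. -/
structure HasReservation [Preorder X] (T : ThresholdProblem X Y) (β : ℝ) : Prop where
  strict : (∀ y, StrictMono fun x => T.r (x, y)) ∨ (∀ y, StrictAnti fun x => T.r (x, y))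
  exists_indifferent : ∀ y, ∃ x, T.r (x, y) = T.contValue β y

/-- `xbar : Y → X` is a decision threshold: `r(xbar(y), y) = ψ*(y)` for every `y`. -/
def IsDecisionThreshold (T : ThresholdProblem X Y) (β : ℝ) (xbar : Y → X) : Prop :=
  ∀ y, T.r (xbar y, y) = T.contValue β y

end ThresholdProblem

end

/-!
The value function is approximated by value iteration, `v_0 = r` and `v_{N+1} = max r ψ_N` with
`ψ_N = c + β P v_N`. Exiting when continuing stops being better than `r` attains `v_N`, while
capping an arbitrary stopping time at `N` changes its payoff by at most the discounted moments of
the payoffs beyond time `N`. Hence `v*`, and after one more step `ψ*`, differ from their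
finite-horizon counterparts by a tail of these moments. Iterating the drift inequality bounds the
`t`-th moment by `K t` times the envelope `|r| + ℓ`, where `∑ β ^ t K t < ∞`, so the convergence of
`ψ_N` to `ψ*` is locally uniform in the state and the parameter.

Each `ψ_N` is jointly continuous: the joint law of the next state and the parameter depends weakly
continuously on the current state and parameter, and weak convergence passes to integrals of
functions dominated by an envelope whose own integrals converge. Therefore `ψ*` is jointly
continuous, and strict monotonicity of `r` in `x` transfers this to the solution of `r = ψ*`.
-/

noncomputable section

open Filter Topology

/-! ### The canonical process -/

theorem map_eval_zero_trajMeasure {X : ℕ → Type*} [∀ n, MeasurableSpace (X n)]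
    (μ : Measure (X 0)) [IsProbabilityMeasure μ]
    (κ : (n : ℕ) → Kernel ((i : Finset.Iic n) → X i) (X (n + 1))) [∀ n, IsMarkovKernel (κ n)] :
    (Kernel.trajMeasure μ κ).map (fun ω => ω 0) = μ := by
  let e : ((i : Finset.Iic 0) → X i) ≃ᵐ X 0 := MeasurableEquiv.piUnique fun i : Finset.Iic 0 => X i
  have map_frestrictLe :
      (Kernel.trajMeasure μ κ).map (Preorder.frestrictLe 0) = μ.map e.symm := by
    rw [Kernel.trajMeasure, Measure.map_comp _ _ (by fun_prop),
      Kernel.traj_map_frestrictLe_of_le le_rfl, Measure.deterministic_comp_eq_map]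
    exact Measure.map_id
  calc (Kernel.trajMeasure μ κ).map (fun ω => ω 0)
      = ((Kernel.trajMeasure μ κ).map (Preorder.frestrictLe 0)).map e :=
        (Measure.map_map e.measurable (Preorder.measurable_frestrictLe 0)).symm
    _ = μ := by rw [map_frestrictLe, MeasurableEquiv.map_map_symm]

theorem measurable_eval_piLE {X : ℕ → Type*} [∀ n, MeasurableSpace (X n)] (t : ℕ) :
    Measurable[Filtration.piLE (X := X) t] fun ω : (n : ℕ) → X n => ω t := by
  rw [Filtration.piLE_eq_comap_frestrictLe]
  exact (measurable_pi_apply (⟨t, Finset.mem_Iic.2 le_rfl⟩ : Finset.Iic t)).comp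
    (comap_measurable (Preorder.frestrictLe t))

section KernelPow

variable {Z : Type*} [MeasurableSpace Z] (κ : Kernel Z Z) {h : Z → ℝ≥0∞}

theorem lintegral_kernel_pow_zero (hh : Measurable h) (z : Z) : ∫⁻ z', h z' ∂((κ ^ 0) z) = h z := by
  rw [pow_zero]
  exact lintegral_dirac' z hh

theorem lintegral_kernel_pow_add (hh : Measurable h) (s t : ℕ) (z : Z) :
    ∫⁻ z', h z' ∂((κ ^ (s + t)) z) = ∫⁻ z', ∫⁻ z'', h z'' ∂((κ ^ t) z') ∂((κ ^ s) z) := by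
  rw [add_comm, pow_add]
  exact Kernel.lintegral_comp _ _ _ hh

end KernelPow

namespace StoppingProblem

variable {Z : Type*} [MeasurableSpace Z] (D : StoppingProblem Z)

instance isProbabilityMeasure_pathLaw (z : Z) : IsProbabilityMeasure (D.pathLaw z) := by
  unfold pathLaw; infer_instance

theorem map_frestrictLe_prod_eval_succ_pathLaw (t : ℕ) (z : Z) :
    (D.pathLaw z).map (fun ω => (Preorder.frestrictLe t ω, ω (t + 1))) =
      (D.pathLaw z).map (Preorder.frestrictLe t) ⊗ₘ D.historyKernel t :=
  Kernel.map_frestrictLe_trajMeasure_compProd_eq_map_trajMeasure.symm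

theorem map_eval_succ_pathLaw (t : ℕ) (z : Z) :
    (D.pathLaw z).map (fun ω => ω (t + 1)) = D.P ∘ₘ (D.pathLaw z).map (fun ω => ω t) := by
  have map_pair_snd := congrArg Measure.snd (D.map_frestrictLe_prod_eval_succ_pathLaw t z)
  rw [Measure.snd_map_prodMk (by fun_prop), Measure.snd_compProd] at map_pair_snd
  rw [map_pair_snd, historyKernel, ← Kernel.comp_deterministic_eq_comap, ← Measure.comp_assoc,
    Measure.deterministic_comp_eq_map, Measure.map_map (by fun_prop) (by fun_prop)]
  rfl

theorem map_eval_pathLaw (t : ℕ) (z : Z) : (D.pathLaw z).map (fun ω => ω t) = (D.P ^ t) z := by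
  induction t with
  | zero => exact map_eval_zero_trajMeasure _ _
  | succ t ih =>
    rw [map_eval_succ_pathLaw, ih, pow_succ']
    exact (Kernel.comp_apply D.P (D.P ^ t) z).symm

theorem lintegral_eval {h : Z → ℝ≥0∞} (hh : Measurable h) (t : ℕ) (z : Z) :
    ∫⁻ ω, h (ω t) ∂(D.pathLaw z) = ∫⁻ z', h z' ∂((D.P ^ t) z) := by
  rw [← map_eval_pathLaw, lintegral_map hh (measurable_pi_apply t)]

theorem integral_eval_zero {h : Z → ℝ} (hh : Measurable h) (z : Z) :
    ∫ ω, h (ω 0) ∂(D.pathLaw z) = h z := by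
  rw [← integral_map (φ := fun ω : ℕ → Z => ω 0) (measurable_pi_apply 0).aemeasurable
    hh.aestronglyMeasurable, map_eval_pathLaw, pow_zero]
  exact integral_dirac' h z hh.stronglyMeasurable

theorem setIntegral_eval_succ {h : Z → ℝ} (hh : Measurable h) {t : ℕ} {z : Z}
    (hi : Integrable (fun ω : ℕ → Z => h (ω (t + 1))) (D.pathLaw z)) {A : Set (ℕ → Z)}
    (hA : MeasurableSet[Filtration.piLE (X := fun _ : ℕ => Z) t] A) :
    ∫ ω in A, h (ω (t + 1)) ∂(D.pathLaw z) =
      ∫ ω in A, ∫ z', h z' ∂(D.P (ω t)) ∂(D.pathLaw z) := by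
  rw [Filtration.piLE_eq_comap_frestrictLe] at hA
  obtain ⟨B, hB, rfl⟩ := hA
  let pair : (ℕ → Z) → ((i : Finset.Iic t) → (fun _ : ℕ => Z) i) × Z :=
    fun ω => (Preorder.frestrictLe t ω, ω (t + 1))
  have measurable_pair : Measurable pair := by fun_prop
  have measurable_h_snd :
      Measurable fun p : ((i : Finset.Iic t) → (fun _ : ℕ => Z) i) × Z => h p.2 :=
    hh.comp measurable_snd
  have map_pair : (D.pathLaw z).map pair = _ := D.map_frestrictLe_prod_eval_succ_pathLaw t z
  have integrable_snd : Integrable (fun p => h p.2) ((D.pathLaw z).map pair) :=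
    (integrable_map_measure measurable_h_snd.aestronglyMeasurable measurable_pair.aemeasurable).2 hi
  calc ∫ ω in Preorder.frestrictLe t ⁻¹' B, h (ω (t + 1)) ∂(D.pathLaw z)
      = ∫ ω in pair ⁻¹' (B ×ˢ Set.univ), h (ω (t + 1)) ∂(D.pathLaw z) := by
        rw [Set.mk_preimage_prod, Set.preimage_univ, Set.inter_univ]
    _ = ∫ p in B ×ˢ Set.univ, h p.2 ∂((D.pathLaw z).map pair) :=
        (setIntegral_map (hB.prod .univ) measurable_h_snd.aestronglyMeasurable
          measurable_pair.aemeasurable).symm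
    _ = ∫ x in B, ∫ z', h z' ∂(D.historyKernel t x)
          ∂((D.pathLaw z).map (Preorder.frestrictLe t)) := by
        rw [map_pair] at integrable_snd ⊢
        simpa only [Measure.restrict_univ] using
          Measure.setIntegral_compProd hB .univ integrable_snd.integrableOn
    _ = ∫ ω in Preorder.frestrictLe t ⁻¹' B, ∫ z', h z' ∂(D.P (ω t)) ∂(D.pathLaw z) :=
        setIntegral_map hB
          (StronglyMeasurable.integral_kernel hh.stronglyMeasurable).aestronglyMeasurable
          (by fun_prop)

/-! ### Moments -/

/-- The `t`-step moment `𝔼_z |r(Z_t)| + 𝔼_z |c(Z_t)|` of both payoffs. -/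
def totalMoment (t : ℕ) (z : Z) : ℝ≥0∞ := D.absMoment D.r t z + D.absMoment D.c t z

section AbsMoment

variable {h : Z → ℝ}

theorem absMoment_eq_lintegral_enorm (t : ℕ) (z : Z) :
    D.absMoment h t z = ∫⁻ z', ‖h z'‖ₑ ∂((D.P ^ t) z) := by
  simp only [absMoment, Real.enorm_eq_ofReal_abs]

theorem measurable_absMoment (hh : Measurable h) (t : ℕ) : Measurable (D.absMoment h t) :=
  Measurable.lintegral_kernel (κ := D.P ^ t) (by fun_prop)

theorem absMoment_zero (hh : Measurable h) (z : Z) : D.absMoment h 0 z = ‖h z‖ₑ := by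
  rw [absMoment_eq_lintegral_enorm, lintegral_kernel_pow_zero _ hh.enorm]

theorem lintegral_pow_absMoment (hh : Measurable h) (s t : ℕ) (z : Z) :
    ∫⁻ z', D.absMoment h t z' ∂((D.P ^ s) z) = D.absMoment h (s + t) z := by
  simp only [absMoment_eq_lintegral_enorm]
  exact (lintegral_kernel_pow_add _ hh.enorm s t z).symm

theorem lintegral_enorm_eval (hh : Measurable h) (t : ℕ) (z : Z) :
    ∫⁻ ω, ‖h (ω t)‖ₑ ∂(D.pathLaw z) = D.absMoment h t z := by
  rw [absMoment_eq_lintegral_enorm, ← D.lintegral_eval hh.enorm]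

theorem integrable_eval (hh : Measurable h) {t : ℕ} {z : Z} (hf : D.absMoment h t z ≠ ∞) :
    Integrable (fun ω : ℕ → Z => h (ω t)) (D.pathLaw z) := by
  refine ⟨(hh.comp (measurable_pi_apply t)).aestronglyMeasurable, ?_⟩
  rw [HasFiniteIntegral, D.lintegral_enorm_eval hh]
  exact hf.lt_top

theorem integrable_of_absMoment_one_ne_top (hh : Measurable h) {z : Z}
    (hf : D.absMoment h 1 z ≠ ∞) : Integrable h (D.P z) := by
  refine ⟨hh.aestronglyMeasurable, ?_⟩
  rw [absMoment_eq_lintegral_enorm, pow_one] at hf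
  exact hf.lt_top

theorem absMoment_integral_le (hh : Measurable h) (t : ℕ) (z : Z) :
    D.absMoment (fun z' => ∫ z'', h z'' ∂(D.P z')) t z ≤ D.absMoment h (t + 1) z := by
  rw [← D.lintegral_pow_absMoment hh, absMoment_eq_lintegral_enorm]
  refine lintegral_mono fun z' => ?_
  rw [absMoment_eq_lintegral_enorm, pow_one]
  exact enorm_integral_le_lintegral_enorm h

end AbsMoment

theorem measurable_totalMoment (t : ℕ) : Measurable (D.totalMoment t) :=
  (D.measurable_absMoment D.measurable_r t).add (D.measurable_absMoment D.measurable_c t)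

theorem lintegral_pow_totalMoment (s t : ℕ) (z : Z) :
    ∫⁻ z', D.totalMoment t z' ∂((D.P ^ s) z) = D.totalMoment (s + t) z := by
  unfold totalMoment
  rw [lintegral_add_left (D.measurable_absMoment D.measurable_r t),
    D.lintegral_pow_absMoment D.measurable_r, D.lintegral_pow_absMoment D.measurable_c]

theorem lintegral_totalMoment (t : ℕ) (z : Z) :
    ∫⁻ z', D.totalMoment t z' ∂(D.P z) = D.totalMoment (t + 1) z := by
  rw [add_comm, ← lintegral_pow_totalMoment, pow_one]

end StoppingProblem

/-! ### Optional stopping -/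

section StoppedProcess

variable {Ω E : Type*} {τ : Ω → WithTop ℕ}

theorem stoppedProcess_eq_add_sum_indicator [AddCommGroup E] (u : ℕ → Ω → E) (N : ℕ) (ω : Ω) :
    stoppedProcess u τ N ω = u 0 ω + ∑ s ∈ Finset.range N,
      {ω | (s : WithTop ℕ) < τ ω}.indicator (fun ω => u (s + 1) ω - u s ω) ω := by
  induction N with
  | zero =>
    have hzero : ((0 : ℕ) : WithTop ℕ) ≤ τ ω := bot_le
    rw [stoppedProcess_eq_of_le (i := 0) hzero, Finset.sum_range_zero, add_zero]
  | succ N ih =>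
    rw [Finset.sum_range_succ, ← add_assoc, ← ih]
    rcases lt_or_ge (N : WithTop ℕ) (τ ω) with h | h
    · have hsucc : ((N + 1 : ℕ) : WithTop ℕ) ≤ τ ω :=
        Order.add_one_le_of_lt (α := ℕ∞) h
      rw [Set.indicator_of_mem (by exact h), stoppedProcess_eq_of_le (i := N) h.le,
        stoppedProcess_eq_of_le (i := N + 1) hsucc]
      abel
    · have hsucc : τ ω ≤ (N + 1 : ℕ) := h.trans (by exact_mod_cast N.le_succ)
      rw [Set.indicator_of_notMem (by exact h.not_gt), add_zero,
        stoppedProcess_eq_of_ge (i := N) h, stoppedProcess_eq_of_ge (i := N + 1) hsucc]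

theorem integral_stoppedProcess [mΩ : MeasurableSpace Ω] [NormedAddCommGroup E] [NormedSpace ℝ E]
    {u : ℕ → Ω → E} {μ : Measure Ω} {ℱ : Filtration ℕ mΩ} (hτ : IsStoppingTime ℱ τ)
    (hu : ∀ s, Integrable (u s) μ) (N : ℕ) :
    ∫ ω, stoppedProcess u τ N ω ∂μ = ∫ ω, u 0 ω ∂μ + ∑ s ∈ Finset.range N,
      ∫ ω in {ω | (s : WithTop ℕ) < τ ω}, (u (s + 1) ω - u s ω) ∂μ := by
  have measurableSet_lt (s : ℕ) : MeasurableSet {ω | (s : WithTop ℕ) < τ ω} :=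
    ℱ.le s _ (hτ.measurableSet_gt s)
  have integrable_increment (s : ℕ) : Integrable
      ({ω | (s : WithTop ℕ) < τ ω}.indicator fun ω => u (s + 1) ω - u s ω) μ :=
    ((hu (s + 1)).sub (hu s)).indicator (measurableSet_lt s)
  simp_rw [stoppedProcess_eq_add_sum_indicator]
  rw [integral_add (hu 0) (integrable_finsetSum _ fun s _ => integrable_increment s),
    integral_finsetSum _ fun s _ => integrable_increment s]
  simp_rw [integral_indicator (measurableSet_lt _)]

end StoppedProcess

/-! ### Value iteration -/

namespace StoppingProblem

variable {Z : Type*} [MeasurableSpace Z] (D : StoppingProblem Z) (β : ℝ)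

/-- The value `v_N` of the problem in which exit is forced at time `N` at the latest, given by
`N`-fold iteration of the Bellman operator on the exit payoff. -/
def finiteHorizonValue : ℕ → Z → ℝ
  | 0 => D.r
  | N + 1 => fun z => max (D.r z) (D.c z + β * ∫ z', finiteHorizonValue N z' ∂(D.P z))

/-- The continuation value `ψ_N = c + β P v_N` when exit is forced within `N` periods after the
current one. -/
def finiteHorizonContValue (N : ℕ) (z : Z) : ℝ :=
  D.c z + β * ∫ z', D.finiteHorizonValue β N z' ∂(D.P z)

theorem finiteHorizonValue_succ (N : ℕ) (z : Z) :
    D.finiteHorizonValue β (N + 1) z = max (D.r z) (D.finiteHorizonContValue β N z) := rfl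

theorem finiteHorizonValue_sub {N s : ℕ} (hs : s < N) (z : Z) :
    D.finiteHorizonValue β (N - s) z =
      max (D.r z) (D.finiteHorizonContValue β (N - (s + 1)) z) := by
  rw [← finiteHorizonValue_succ, Nat.sub_add_eq, Nat.sub_add_cancel (Nat.sub_pos_of_lt hs)]

theorem r_le_finiteHorizonValue (N : ℕ) (z : Z) : D.r z ≤ D.finiteHorizonValue β N z := by
  cases N with
  | zero => exact le_rfl
  | succ N => exact le_max_left _ _

theorem measurable_finiteHorizonValue (N : ℕ) : Measurable (D.finiteHorizonValue β N) := by
  induction N with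
  | zero => exact D.measurable_r
  | succ N ih =>
    exact D.measurable_r.max (D.measurable_c.add
      ((StronglyMeasurable.integral_kernel (κ := D.P) ih.stronglyMeasurable).measurable.const_mul
        β))

theorem enorm_finiteHorizonValue_le (N : ℕ) (z : Z) :
    ‖D.finiteHorizonValue β N z‖ₑ ≤ ∑ t ∈ Finset.range (N + 1), ‖β‖ₑ ^ t * D.totalMoment t z := by
  have totalMoment_zero (z : Z) : D.totalMoment 0 z = ‖D.r z‖ₑ + ‖D.c z‖ₑ := by
    rw [totalMoment, D.absMoment_zero D.measurable_r, D.absMoment_zero D.measurable_c]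
  induction N generalizing z with
  | zero => simp [finiteHorizonValue, totalMoment_zero]
  | succ N ih =>
    have enorm_integral_le : ‖∫ z', D.finiteHorizonValue β N z' ∂(D.P z)‖ₑ ≤
        ∑ t ∈ Finset.range (N + 1), ‖β‖ₑ ^ t * D.totalMoment (t + 1) z := by
      refine (enorm_integral_le_lintegral_enorm _).trans ((lintegral_mono ih).trans_eq ?_)
      rw [lintegral_finsetSum _ fun t _ => (D.measurable_totalMoment t).const_mul _]
      simp_rw [lintegral_const_mul _ (D.measurable_totalMoment _), lintegral_totalMoment]
    calc ‖D.finiteHorizonValue β (N + 1) z‖ₑ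
        ≤ ‖D.r z‖ₑ + ‖D.finiteHorizonContValue β N z‖ₑ := by
          rw [finiteHorizonValue_succ]
          rcases max_choice (D.r z) (D.finiteHorizonContValue β N z) with h | h <;> simp [h]
      _ ≤ ‖D.r z‖ₑ + (‖D.c z‖ₑ + ‖β‖ₑ * ‖∫ z', D.finiteHorizonValue β N z' ∂(D.P z)‖ₑ) := by
          gcongr
          exact (enorm_add_le _ _).trans_eq (by rw [enorm_mul])
      _ ≤ D.totalMoment 0 z +
          ‖β‖ₑ * ∑ t ∈ Finset.range (N + 1), ‖β‖ₑ ^ t * D.totalMoment (t + 1) z := by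
          rw [totalMoment_zero, add_assoc]
          gcongr
      _ = ∑ t ∈ Finset.range (N + 1 + 1), ‖β‖ₑ ^ t * D.totalMoment t z := by
          rw [Finset.sum_range_succ' _ (N + 1), Finset.mul_sum, pow_zero, one_mul, add_comm]
          simp_rw [pow_succ', mul_assoc]

section Integrable

variable {D} {z : Z} (hfin : ∀ t, D.totalMoment t z ≠ ∞)
include hfin

theorem absMoment_finiteHorizonValue_ne_top (N t : ℕ) :
    D.absMoment (D.finiteHorizonValue β N) t z ≠ ∞ := by
  rw [absMoment_eq_lintegral_enorm]
  refine ne_top_of_le_ne_top ?_ (lintegral_mono (D.enorm_finiteHorizonValue_le β N))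
  rw [lintegral_finsetSum _ fun s _ => (D.measurable_totalMoment s).const_mul _]
  simp_rw [lintegral_const_mul _ (D.measurable_totalMoment _), lintegral_pow_totalMoment]
  exact ENNReal.sum_ne_top.2 fun s _ =>
    ENNReal.mul_ne_top (ENNReal.pow_ne_top enorm_ne_top) (hfin _)

theorem integrable_finiteHorizonValue (N : ℕ) : Integrable (D.finiteHorizonValue β N) (D.P z) :=
  D.integrable_of_absMoment_one_ne_top (D.measurable_finiteHorizonValue β N)
    (absMoment_finiteHorizonValue_ne_top β hfin N 1)

theorem integrable_finiteHorizonValue_eval (N t : ℕ) :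
    Integrable (fun ω : ℕ → Z => D.finiteHorizonValue β N (ω t)) (D.pathLaw z) :=
  D.integrable_eval (D.measurable_finiteHorizonValue β N)
    (absMoment_finiteHorizonValue_ne_top β hfin N t)

theorem integrable_integral_finiteHorizonValue_eval (N t : ℕ) :
    Integrable (fun ω : ℕ → Z => ∫ z', D.finiteHorizonValue β N z' ∂(D.P (ω t)))
      (D.pathLaw z) := by
  have hv := D.measurable_finiteHorizonValue β N
  refine D.integrable_eval (h := fun z' => ∫ z'', D.finiteHorizonValue β N z'' ∂(D.P z'))
    (StronglyMeasurable.integral_kernel hv.stronglyMeasurable).measurable ?_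
  exact ne_top_of_le_ne_top (absMoment_finiteHorizonValue_ne_top β hfin N (t + 1))
    (D.absMoment_integral_le hv t z)

theorem integrable_c_eval (t : ℕ) : Integrable (fun ω : ℕ → Z => D.c (ω t)) (D.pathLaw z) :=
  D.integrable_eval D.measurable_c (ENNReal.add_ne_top.1 (hfin t)).2

theorem integrable_finiteHorizonContValue_eval (N t : ℕ) :
    Integrable (fun ω : ℕ → Z => D.finiteHorizonContValue β N (ω t)) (D.pathLaw z) :=
  (integrable_c_eval hfin t).add
    ((integrable_integral_finiteHorizonValue_eval β hfin N t).const_mul β)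

theorem integrable_r_eval (t : ℕ) : Integrable (fun ω : ℕ → Z => D.r (ω t)) (D.pathLaw z) :=
  D.integrable_eval D.measurable_r (ENNReal.add_ne_top.1 (hfin t)).1

theorem integrable_payoff (k : ℕ) : Integrable (fun ω => D.payoff β ω k) (D.pathLaw z) :=
  (integrable_finsetSum _ fun t _ => (integrable_c_eval hfin t).const_mul _).add
    ((integrable_r_eval hfin k).const_mul _)

end Integrable

/-! ### Dynamic programming over a finite horizon -/

/-- The payoff of continuing up to time `t` and collecting the value of the remaining problem with
horizon `N - t` then; meaningful for `t ≤ N` only. -/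
def gain (N t : ℕ) (ω : ℕ → Z) : ℝ :=
  (∑ s ∈ Finset.range t, β ^ s * D.c (ω s)) + β ^ t * D.finiteHorizonValue β (N - t) (ω t)

theorem gain_succ_sub (N s : ℕ) (ω : ℕ → Z) :
    D.gain β N (s + 1) ω - D.gain β N s ω =
      β ^ s * (D.finiteHorizonContValue β (N - (s + 1)) (ω s) -
        D.finiteHorizonValue β (N - s) (ω s)) +
      β ^ (s + 1) * (D.finiteHorizonValue β (N - (s + 1)) (ω (s + 1)) -
        ∫ z', D.finiteHorizonValue β (N - (s + 1)) z' ∂(D.P (ω s))) := by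
  rw [gain, gain, Finset.sum_range_succ, finiteHorizonContValue]
  ring

variable {β} in
theorem payoff_le_gain (hβ : 0 ≤ β) (N k : ℕ) (ω : ℕ → Z) : D.payoff β ω k ≤ D.gain β N k ω := by
  unfold payoff gain
  have := D.r_le_finiteHorizonValue β (N - k) (ω k)
  gcongr

theorem integral_gain_zero (N : ℕ) (z : Z) :
    ∫ ω, D.gain β N 0 ω ∂(D.pathLaw z) = D.finiteHorizonValue β N z := by
  simpa [gain] using D.integral_eval_zero (D.measurable_finiteHorizonValue β N) z

section Gain

variable {D} {z : Z} (hfin : ∀ t, D.totalMoment t z ≠ ∞)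
include hfin

theorem integrable_gain (N t : ℕ) : Integrable (D.gain β N t) (D.pathLaw z) :=
  (integrable_finsetSum _ fun s _ => (integrable_c_eval hfin s).const_mul _).add
    ((integrable_finiteHorizonValue_eval β hfin _ t).const_mul _)

theorem setIntegral_gain_succ_sub (N s : ℕ) {A : Set (ℕ → Z)}
    (hA : MeasurableSet[Filtration.piLE (X := fun _ : ℕ => Z) s] A) :
    ∫ ω in A, (D.gain β N (s + 1) ω - D.gain β N s ω) ∂(D.pathLaw z) =
      ∫ ω in A, β ^ s * (D.finiteHorizonContValue β (N - (s + 1)) (ω s) -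
        D.finiteHorizonValue β (N - s) (ω s)) ∂(D.pathLaw z) := by
  have integrable_next := integrable_finiteHorizonValue_eval β hfin (N - (s + 1)) (s + 1)
  have integrable_expected := integrable_integral_finiteHorizonValue_eval β hfin (N - (s + 1)) s
  have integrable_surprise := (integrable_next.sub integrable_expected).const_mul (β ^ (s + 1))
  have integrable_drift := ((integrable_finiteHorizonContValue_eval β hfin (N - (s + 1)) s).sub
    (integrable_finiteHorizonValue_eval β hfin (N - s) s)).const_mul (β ^ s)
  simp only [Pi.sub_apply] at integrable_surprise integrable_drift
  simp_rw [gain_succ_sub]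
  rw [integral_add integrable_drift.integrableOn integrable_surprise.integrableOn, add_eq_left,
    integral_const_mul, integral_sub integrable_next.integrableOn integrable_expected.integrableOn,
    D.setIntegral_eval_succ (D.measurable_finiteHorizonValue β _) integrable_next hA, sub_self,
    mul_zero]

theorem integral_stoppedProcess_gain {τ : (ℕ → Z) → WithTop ℕ}
    (hτ : IsStoppingTime (Filtration.piLE (X := fun _ : ℕ => Z)) τ) (N : ℕ) :
    ∫ ω, stoppedProcess (D.gain β N) τ N ω ∂(D.pathLaw z) =
      D.finiteHorizonValue β N z + ∑ s ∈ Finset.range N,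
        ∫ ω in {ω | (s : WithTop ℕ) < τ ω}, β ^ s *
          (D.finiteHorizonContValue β (N - (s + 1)) (ω s) -
            D.finiteHorizonValue β (N - s) (ω s)) ∂(D.pathLaw z) := by
  rw [integral_stoppedProcess hτ (integrable_gain β hfin N), integral_gain_zero]
  exact congrArg _ (Finset.sum_congr rfl fun s _ =>
    setIntegral_gain_succ_sub β hfin N s (hτ.measurableSet_gt s))

variable {β} in
theorem integral_stoppedProcess_payoff_le (hβ : 0 ≤ β) {τ : (ℕ → Z) → WithTop ℕ}
    (hτ : IsStoppingTime (Filtration.piLE (X := fun _ : ℕ => Z)) τ) (N : ℕ) :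
    ∫ ω, stoppedProcess (fun k ω => D.payoff β ω k) τ N ω ∂(D.pathLaw z) ≤
      D.finiteHorizonValue β N z := by
  calc ∫ ω, stoppedProcess (fun k ω => D.payoff β ω k) τ N ω ∂(D.pathLaw z)
      ≤ ∫ ω, stoppedProcess (D.gain β N) τ N ω ∂(D.pathLaw z) :=
        integral_mono (integrable_stoppedProcess hτ (integrable_payoff β hfin) N)
          (integrable_stoppedProcess hτ (integrable_gain β hfin N) N)
          fun ω => D.payoff_le_gain hβ N _ ω
    _ ≤ D.finiteHorizonValue β N z := by
        rw [integral_stoppedProcess_gain β hfin hτ, add_le_iff_nonpos_right]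
        refine Finset.sum_nonpos fun s hs => integral_nonpos fun ω => ?_
        refine mul_nonpos_of_nonneg_of_nonpos (pow_nonneg hβ s) (sub_nonpos.2 ?_)
        rw [D.finiteHorizonValue_sub β (Finset.mem_range.1 hs)]
        exact le_max_right _ _

end Gain

/-- The first time at which exiting is optimal when exit is forced at time `N` at the latest. -/
def greedyTime (N : ℕ) : (ℕ → Z) → ℕ :=
  hittingBtwn (fun k ω => D.r (ω k) - D.finiteHorizonValue β (N - k) (ω k)) {0} 0 N

theorem greedyTime_le (N : ℕ) (ω : ℕ → Z) : D.greedyTime β N ω ≤ N :=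
  hittingBtwn_le ω

theorem r_greedyTime (N : ℕ) (ω : ℕ → Z) :
    D.r (ω (D.greedyTime β N ω)) =
      D.finiteHorizonValue β (N - D.greedyTime β N ω) (ω (D.greedyTime β N ω)) :=
  sub_eq_zero.1 (hittingBtwn_mem_set
    (u := fun k (ω : ℕ → Z) => D.r (ω k) - D.finiteHorizonValue β (N - k) (ω k)) (s := {0})
    ⟨N, ⟨N.zero_le, le_rfl⟩, by simp [finiteHorizonValue]⟩)

theorem r_ne_of_lt_greedyTime {N k : ℕ} {ω : ℕ → Z} (hk : k < D.greedyTime β N ω) :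
    D.r (ω k) ≠ D.finiteHorizonValue β (N - k) (ω k) :=
  fun h => notMem_of_lt_hittingBtwn hk k.zero_le (sub_eq_zero.2 h)

theorem isStoppingTime_greedyTime (N : ℕ) :
    IsStoppingTime (Filtration.piLE (X := fun _ : ℕ => Z))
      fun ω => (D.greedyTime β N ω : WithTop ℕ) :=
  Adapted.isStoppingTime_hittingBtwn
    (fun k => (D.measurable_r.sub (D.measurable_finiteHorizonValue β (N - k))).comp
      (measurable_eval_piLE k)) (measurableSet_singleton 0)

theorem greedyTime_mem_stoppingTimes (N : ℕ) :
    (fun ω => (D.greedyTime β N ω : WithTop ℕ)) ∈ D.stoppingTimes :=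
  ⟨D.isStoppingTime_greedyTime β N, fun _ => Eventually.of_forall fun _ => WithTop.coe_ne_top⟩

theorem integral_payoff_greedyTime {z : Z} (hfin : ∀ t, D.totalMoment t z ≠ ∞) (N : ℕ) :
    ∫ ω, D.payoff β ω (D.greedyTime β N ω) ∂(D.pathLaw z) = D.finiteHorizonValue β N z := by
  have payoff_eq (ω : ℕ → Z) : D.payoff β ω (D.greedyTime β N ω) =
      stoppedProcess (D.gain β N) (fun ω => (D.greedyTime β N ω : WithTop ℕ)) N ω := by
    rw [stoppedProcess_eq_of_ge (τ := fun ω => (D.greedyTime β N ω : WithTop ℕ)) (i := N)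
      (WithTop.coe_le_coe.2 (D.greedyTime_le β N ω)), payoff, r_greedyTime]
    rfl
  simp_rw [payoff_eq]
  rw [integral_stoppedProcess_gain β hfin (D.isStoppingTime_greedyTime β N), add_eq_left]
  refine Finset.sum_eq_zero fun s hs => setIntegral_eq_zero_of_forall_eq_zero fun ω hω => ?_
  have continuing_is_optimal := D.finiteHorizonValue_sub β (Finset.mem_range.1 hs) (ω s)
  have exiting_is_not := D.r_ne_of_lt_greedyTime (k := s) β (WithTop.coe_lt_coe.1 hω)
  rw [continuing_is_optimal, max_eq_right, sub_self, mul_zero]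
  by_contra! h
  exact exiting_is_not (by rw [continuing_is_optimal, max_eq_left h.le])

end StoppingProblem

/-! ### Value iteration converges to the value function -/

namespace StoppingProblem

variable {Z : Type*} [MeasurableSpace Z] (D : StoppingProblem Z)

theorem measurable_payoff (β : ℝ) : Measurable fun p : (ℕ → Z) × ℕ => D.payoff β p.1 p.2 := by
  have hr := D.measurable_r
  have hc := D.measurable_c
  refine measurable_from_prod_countable_left fun k => ?_
  simp only [payoff]
  fun_prop

/-- The discounted moments of the payoffs from time `N` on: a bound on the loss caused by forcing
exit at time `N`. -/
def tailMoment (β : ℝ) (N : ℕ) (z : Z) : ℝ≥0∞ :=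
  ∑' t, ‖β‖ₑ ^ (t + N) * D.totalMoment (t + N) z

theorem mul_lintegral_tailMoment (β : ℝ) (N : ℕ) (z : Z) :
    ‖β‖ₑ * ∫⁻ z', D.tailMoment β N z' ∂(D.P z) = D.tailMoment β (N + 1) z := by
  unfold tailMoment
  rw [lintegral_tsum fun t => ((D.measurable_totalMoment (t + N)).const_mul _).aemeasurable,
    ← ENNReal.tsum_mul_left]
  simp_rw [lintegral_const_mul _ (D.measurable_totalMoment _), lintegral_totalMoment, ← mul_assoc,
    ← pow_succ', add_assoc]

theorem lintegral_tsum_enorm_eval (β : ℝ) (N : ℕ) (z : Z) :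
    ∫⁻ ω, ∑' t, ‖β‖ₑ ^ (t + N) * (‖D.r (ω (t + N))‖ₑ + ‖D.c (ω (t + N))‖ₑ) ∂(D.pathLaw z) =
      D.tailMoment β N z := by
  have hr := D.measurable_r
  have hc := D.measurable_c
  rw [lintegral_tsum fun t => by fun_prop]
  refine tsum_congr fun t => ?_
  rw [lintegral_const_mul _ (by fun_prop), lintegral_add_left (by fun_prop),
    D.lintegral_enorm_eval hr, D.lintegral_enorm_eval hc, totalMoment]

theorem enorm_payoff_sub_payoff_min_le (β : ℝ) (N k : ℕ) (ω : ℕ → Z) :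
    ‖D.payoff β ω k - D.payoff β ω (min k N)‖ₑ ≤
      ∑' t, ‖β‖ₑ ^ (t + N) * (‖D.r (ω (t + N))‖ₑ + ‖D.c (ω (t + N))‖ₑ) := by
  rcases le_or_gt k N with h | h
  · simp [min_eq_left h]
  obtain ⟨j, rfl⟩ := Nat.exists_eq_add_of_lt h
  let exit (t : ℕ) : ℝ := β ^ (t + N) * D.r (ω (t + N))
  let flow (t : ℕ) : ℝ := β ^ (t + N) * D.c (ω (t + N))
  have payoff_sub : D.payoff β ω (N + j + 1) - D.payoff β ω (min (N + j + 1) N) =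
      ∑ t ∈ Finset.range (j + 1), flow t + exit (j + 1) - exit 0 := by
    rw [min_eq_right h.le, add_assoc, payoff, payoff, Finset.sum_range_add]
    simp only [exit, flow, zero_add, add_comm N]
    ring
  calc ‖D.payoff β ω (N + j + 1) - D.payoff β ω (min (N + j + 1) N)‖ₑ
      ≤ ‖∑ t ∈ Finset.range (j + 1), flow t‖ₑ + ‖exit (j + 1)‖ₑ + ‖exit 0‖ₑ := by
        rw [payoff_sub]
        exact (enorm_sub_le).trans (add_le_add_left (enorm_add_le _ _) _)
    _ ≤ ∑ t ∈ Finset.range (j + 1), ‖flow t‖ₑ + ∑ t ∈ {0, j + 1}, ‖exit t‖ₑ := by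
        rw [Finset.sum_pair j.succ_ne_zero.symm, add_assoc, add_comm ‖exit (j + 1)‖ₑ]
        gcongr
        exact enorm_sum_le _ _
    _ ≤ ∑' t, ‖flow t‖ₑ + ∑' t, ‖exit t‖ₑ :=
        add_le_add (ENNReal.sum_le_tsum _) (ENNReal.sum_le_tsum _)
    _ = ∑' t, ‖β‖ₑ ^ (t + N) * (‖D.r (ω (t + N))‖ₑ + ‖D.c (ω (t + N))‖ₑ) := by
        rw [add_comm, ← ENNReal.tsum_add]
        simp only [exit, flow, enorm_mul, enorm_pow, mul_add]

variable {D} {β : ℝ} {z : Z}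

theorem tailMoment_ne_top (hz : D.tailMoment β 0 z ≠ ∞) (N : ℕ) : D.tailMoment β N z ≠ ∞ :=
  ne_top_of_le_ne_top hz (ENNReal.tsum_comp_le_tsum_of_injective (add_left_injective N) fun t =>
    ‖β‖ₑ ^ t * D.totalMoment t z)

theorem tendsto_tailMoment (hz : D.tailMoment β 0 z ≠ ∞) :
    Tendsto (fun N => D.tailMoment β N z) atTop (𝓝 0) :=
  ENNReal.tendsto_sum_nat_add _ hz

theorem totalMoment_ne_top (hβ : β ≠ 0) (hz : D.tailMoment β 0 z ≠ ∞) (t : ℕ) :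
    D.totalMoment t z ≠ ∞ := by
  intro h
  refine ne_top_of_le_ne_top hz (ENNReal.le_tsum t) ?_
  rw [add_zero, h, ENNReal.mul_top (pow_ne_zero t (enorm_ne_zero.2 hβ))]

theorem lintegral_enorm_payoff_sub_stoppedProcess_le {τ : (ℕ → Z) → WithTop ℕ}
    (hτ : ∀ᵐ ω ∂(D.pathLaw z), τ ω ≠ ⊤) (N : ℕ) :
    ∫⁻ ω, ‖D.payoff β ω ((τ ω).untopD 0) - stoppedProcess (fun k ω => D.payoff β ω k) τ N ω‖ₑ
      ∂(D.pathLaw z) ≤ D.tailMoment β N z := by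
  rw [← lintegral_tsum_enorm_eval]
  refine lintegral_mono_ae ?_
  filter_upwards [hτ] with ω hω
  convert D.enorm_payoff_sub_payoff_min_le β N ((τ ω).untopD 0) ω
  rw [stoppedProcess, min_comm]
  lift τ ω to ℕ using hω with k
  rfl

theorem integral_payoff_le (hβ : 0 < β) (hz : D.tailMoment β 0 z ≠ ∞)
    {τ : (ℕ → Z) → WithTop ℕ} (hτ : τ ∈ D.stoppingTimes) (N : ℕ) :
    ∫ ω, D.payoff β ω ((τ ω).untopD 0) ∂(D.pathLaw z) ≤
      D.finiteHorizonValue β N z + (D.tailMoment β N z).toReal := by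
  have hfin := totalMoment_ne_top hβ.ne' hz
  have htail := lintegral_enorm_payoff_sub_stoppedProcess_le (D := D) (β := β) (hτ.2 z) N
  have integrable_stopped := integrable_stoppedProcess hτ.1 (integrable_payoff β hfin) N
  have aestronglyMeasurable_payoff : AEStronglyMeasurable
      (fun ω => D.payoff β ω ((τ ω).untopD 0)) (D.pathLaw z) :=
    ((D.measurable_payoff β).comp
      (measurable_id.prodMk (hτ.1.measurable'.untopD 0))).aestronglyMeasurable
  have integrable_loss : Integrable (fun ω => D.payoff β ω ((τ ω).untopD 0) -
      stoppedProcess (fun k ω => D.payoff β ω k) τ N ω) (D.pathLaw z) :=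
    ⟨aestronglyMeasurable_payoff.sub integrable_stopped.aestronglyMeasurable,
      htail.trans_lt (tailMoment_ne_top hz N).lt_top⟩
  calc ∫ ω, D.payoff β ω ((τ ω).untopD 0) ∂(D.pathLaw z)
      = ∫ ω, stoppedProcess (fun k ω => D.payoff β ω k) τ N ω ∂(D.pathLaw z) +
        ∫ ω, (D.payoff β ω ((τ ω).untopD 0) -
          stoppedProcess (fun k ω => D.payoff β ω k) τ N ω) ∂(D.pathLaw z) := by
        rw [← integral_add integrable_stopped integrable_loss]
        simp only [add_sub_cancel]
    _ ≤ D.finiteHorizonValue β N z + (D.tailMoment β N z).toReal := by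
        refine add_le_add (integral_stoppedProcess_payoff_le hfin hβ.le hτ.1 N)
          ((Real.le_norm_self _).trans ?_)
        rw [← toReal_enorm]
        exact ENNReal.toReal_mono (tailMoment_ne_top hz N)
          ((enorm_integral_le_lintegral_enorm _).trans htail)

theorem finiteHorizonValue_le_value (hβ : 0 < β) (hz : D.tailMoment β 0 z ≠ ∞) (N : ℕ) :
    D.finiteHorizonValue β N z ≤ D.value β z := by
  rw [← integral_payoff_greedyTime D β (totalMoment_ne_top hβ.ne' hz)]
  refine le_csSup ⟨D.finiteHorizonValue β 0 z + (D.tailMoment β 0 z).toReal, ?_⟩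
    ⟨_, D.greedyTime_mem_stoppingTimes β N, rfl⟩
  rintro _ ⟨τ, hτ, rfl⟩
  exact integral_payoff_le hβ hz hτ 0

theorem value_le (hβ : 0 < β) (hz : D.tailMoment β 0 z ≠ ∞) (N : ℕ) :
    D.value β z ≤ D.finiteHorizonValue β N z + (D.tailMoment β N z).toReal := by
  refine csSup_le ⟨_, _, D.greedyTime_mem_stoppingTimes β N, rfl⟩ ?_
  rintro _ ⟨τ, hτ, rfl⟩
  exact integral_payoff_le hβ hz hτ N

theorem enorm_value_sub_le (hβ : 0 < β) (hz : D.tailMoment β 0 z ≠ ∞) (N : ℕ) :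
    ‖D.value β z - D.finiteHorizonValue β N z‖ₑ ≤ D.tailMoment β N z := by
  rw [Real.enorm_of_nonneg (sub_nonneg.2 (finiteHorizonValue_le_value hβ hz N))]
  exact ENNReal.ofReal_le_of_le_toReal (sub_le_iff_le_add'.2 (value_le hβ hz N))

theorem measurable_value (hβ : 0 < β) (hD : ∀ z, D.tailMoment β 0 z ≠ ∞) :
    Measurable (D.value β) := by
  refine measurable_of_tendsto_metrizable (fun N => D.measurable_finiteHorizonValue β N)
    (tendsto_pi_nhds.2 fun z => tendsto_iff_edist_tendsto_0.2 ?_)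
  refine tendsto_of_tendsto_of_tendsto_of_le_of_le tendsto_const_nhds (tendsto_tailMoment (hD z))
    (fun N => zero_le) fun N => ?_
  rw [edist_comm, edist_eq_enorm_sub]
  exact enorm_value_sub_le hβ (hD z) N

theorem enorm_contValue_sub_le (hβ : 0 < β) (hD : ∀ z, D.tailMoment β 0 z ≠ ∞) (N : ℕ) (z : Z) :
    ‖D.contValue β z - D.finiteHorizonContValue β N z‖ₑ ≤ D.tailMoment β (N + 1) z := by
  have lintegral_loss_le : ∫⁻ z', ‖D.value β z' - D.finiteHorizonValue β N z'‖ₑ ∂(D.P z) ≤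
      ∫⁻ z', D.tailMoment β N z' ∂(D.P z) :=
    lintegral_mono fun z' => enorm_value_sub_le hβ (hD z') N
  have lintegral_tail_ne_top : ∫⁻ z', D.tailMoment β N z' ∂(D.P z) ≠ ∞ := by
    refine fun h => tailMoment_ne_top (hD z) (N + 1) ?_
    rw [← mul_lintegral_tailMoment, h, ENNReal.mul_top (enorm_ne_zero.2 hβ.ne')]
  have integrable_loss :
      Integrable (fun z' => D.value β z' - D.finiteHorizonValue β N z') (D.P z) :=
    ⟨((measurable_value hβ hD).sub (D.measurable_finiteHorizonValue β N)).aestronglyMeasurable,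
      lintegral_loss_le.trans_lt lintegral_tail_ne_top.lt_top⟩
  have contValue_sub : D.contValue β z - D.finiteHorizonContValue β N z =
      β * ∫ z', (D.value β z' - D.finiteHorizonValue β N z') ∂(D.P z) := by
    have integral_value : ∫ z', D.value β z' ∂(D.P z) = ∫ z', D.finiteHorizonValue β N z' ∂(D.P z) +
        ∫ z', (D.value β z' - D.finiteHorizonValue β N z') ∂(D.P z) := by
      rw [← integral_add
        (integrable_finiteHorizonValue β (totalMoment_ne_top hβ.ne' (hD z)) N) integrable_loss]
      simp only [add_sub_cancel]
    rw [contValue, finiteHorizonContValue, integral_value]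
    ring
  calc ‖D.contValue β z - D.finiteHorizonContValue β N z‖ₑ
      ≤ ‖β‖ₑ * ∫⁻ z', D.tailMoment β N z' ∂(D.P z) := by
        rw [contValue_sub, enorm_mul]
        gcongr
        exact (enorm_integral_le_lintegral_enorm _).trans lintegral_loss_le
    _ = D.tailMoment β (N + 1) z := D.mul_lintegral_tailMoment β N z

end StoppingProblem

/-! ### Moment bounds from the drift condition -/

theorem lintegral_kernel_pow_le_of_drift {Z : Type*} [MeasurableSpace Z] {κ : Kernel Z Z}
    [IsMarkovKernel κ] {g : Z → ℝ≥0∞} (hg : Measurable g) {M d : ℝ≥0∞} (hM : 1 ≤ M)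
    (hdrift : ∀ z, ∫⁻ z', g z' ∂(κ z) ≤ M * g z + d) (s : ℕ) (z : Z) :
    ∫⁻ z', g z' ∂((κ ^ s) z) ≤ M ^ s * (g z + d * s) := by
  induction s generalizing z with
  | zero =>
    rw [lintegral_kernel_pow_zero κ hg]
    simp
  | succ s ih =>
    have le_M_mul (a : ℝ≥0∞) : a ≤ M * a := le_mul_of_one_le_left' hM
    calc ∫⁻ z', g z' ∂((κ ^ (s + 1)) z)
        = ∫⁻ z', ∫⁻ z'', g z'' ∂((κ ^ s) z') ∂(κ z) := by
          rw [add_comm, lintegral_kernel_pow_add κ hg, pow_one]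
      _ ≤ ∫⁻ z', M ^ s * (g z' + d * s) ∂(κ z) := lintegral_mono ih
      _ = M ^ s * (∫⁻ z', g z' ∂(κ z) + d * s) := by
          rw [lintegral_const_mul _ (by fun_prop), lintegral_add_left hg, lintegral_const,
            measure_univ, mul_one]
      _ ≤ M ^ s * ((M * g z + M * d) + M * (d * s)) :=
          mul_le_mul_right (add_le_add ((hdrift z).trans (add_le_add_right (le_M_mul d) _))
            (le_M_mul _)) _
      _ = M ^ (s + 1) * (g z + d * (s + 1 : ℕ)) := by
          push_cast
          ring

namespace StoppingProblem

/-- The constant in the bound of the `t`-step moments of the payoffs by the envelope. The first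
summand serves the moments of order below `n`, which occur in the weight with factor `m'`, the
second the higher ones, which are bounded by iterating the drift inequality. -/
def momentFactor (M d m' d' : ℝ≥0) (t : ℕ) : ℝ≥0 := m'⁻¹ + M ^ t * (1 + d / d' * t)

theorem summable_momentFactor {b M : ℝ≥0} (hb : b < 1) (hbM : b * M < 1) (d m' d' : ℝ≥0) :
    Summable fun t => b ^ t * momentFactor M d m' d' t := by
  have summable_pow : Summable fun t : ℕ => b ^ t := NNReal.summable_geometric hb
  have summable_mul_pow : Summable fun t : ℕ => (b * M) ^ t := NNReal.summable_geometric hbM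
  have summable_linear_mul_pow : Summable fun t : ℕ => (t : ℝ≥0) * (b * M) ^ t := by
    rw [← NNReal.summable_coe]
    push_cast
    simpa only [pow_one] using summable_pow_mul_geometric_of_norm_lt_one 1
      (r := (b * M : ℝ)) (by simpa [← NNReal.coe_mul] using hbM)
  refine (((summable_pow.mul_left m'⁻¹).add summable_mul_pow).add
    (summable_linear_mul_pow.mul_left (d / d'))).congr fun t => ?_
  rw [momentFactor, mul_pow]
  ring

variable {Z : Type*} [MeasurableSpace Z] (D : StoppingProblem Z)

/-- The function `|r| + ℓ`, which dominates the moments of all orders of both payoffs; the weight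
`ℓ` alone controls `|r(Z_t)|` for `t ≥ 1` only. -/
def envelope (g : Z → ℝ≥0) (n : ℕ) (m' d' : ℝ≥0) (z : Z) : ℝ≥0∞ :=
  ‖D.r z‖ₑ + D.weight g n m' d' z

variable {D} {g : Z → ℝ≥0} {n₀ n t : ℕ} {β : ℝ} {M d m' d' : ℝ≥0} {f : Z → ℝ} {z : Z}

theorem Drift.absMoment_le (h : D.Drift β g n₀ M d) (hM : 1 ≤ M) (hf : Measurable f)
    (hfg : ∀ z, D.absMoment f n₀ z ≤ g z) (ht : n₀ ≤ t) (z : Z) :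
    D.absMoment f t z ≤ (M : ℝ≥0∞) ^ t * (g z + d * t) := by
  have one_le_M : (1 : ℝ≥0∞) ≤ M := by exact_mod_cast hM
  obtain ⟨s, rfl⟩ := Nat.exists_eq_add_of_le' ht
  calc D.absMoment f (s + n₀) z
      = ∫⁻ z', D.absMoment f n₀ z' ∂((D.P ^ s) z) := (D.lintegral_pow_absMoment hf s n₀ z).symm
    _ ≤ ∫⁻ z', (g z' : ℝ≥0∞) ∂((D.P ^ s) z) := lintegral_mono hfg
    _ ≤ (M : ℝ≥0∞) ^ s * (g z + d * s) :=
        lintegral_kernel_pow_le_of_drift h.measurable_g.coe_nnreal_ennreal one_le_M h.drift s z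
    _ ≤ (M : ℝ≥0∞) ^ (s + n₀) * (g z + d * (s + n₀ : ℕ)) := by
        gcongr <;> exact Nat.le_add_right s n₀

theorem mul_absMoment_c_le_weight (ht : t < n) :
    m' * D.absMoment D.c t z ≤ D.weight g n m' d' z := by
  rw [weight, add_assoc]
  refine le_add_right (mul_le_mul_right (le_add_left ?_) _)
  exact Finset.single_le_sum (f := fun t => D.absMoment D.c t z) (fun _ _ => zero_le)
    (Finset.mem_range.2 ht)

theorem mul_absMoment_r_le_weight (h0 : t ≠ 0) (ht : t < n) :
    m' * D.absMoment D.r t z ≤ D.weight g n m' d' z := by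
  rw [weight, add_assoc]
  refine le_add_right (mul_le_mul_right (le_add_right ?_) _)
  exact Finset.single_le_sum (f := fun t => D.absMoment D.r t z) (fun _ _ => zero_le)
    (Finset.mem_Ico.2 ⟨Nat.one_le_iff_ne_zero.2 h0, ht⟩)

theorem absMoment_le_momentFactor_mul_weight (hm' : 0 < m') (hd' : 0 < d')
    (hlt : t < n → m' * D.absMoment f t z ≤ D.weight g n m' d' z)
    (hge : n ≤ t → D.absMoment f t z ≤ (M : ℝ≥0∞) ^ t * (g z + d * t)) :
    D.absMoment f t z ≤ momentFactor M d m' d' t * D.weight g n m' d' z := by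
  have g_le : (g z : ℝ≥0∞) ≤ D.weight g n m' d' z := by
    rw [weight, add_assoc]
    exact le_add_left le_self_add
  have d_le : (d : ℝ≥0∞) ≤ (d / d' : ℝ≥0) * D.weight g n m' d' z := by
    calc (d : ℝ≥0∞) = (d / d' : ℝ≥0) * (d' : ℝ≥0∞) := by
          rw [← ENNReal.coe_mul, div_mul_cancel₀ _ hd'.ne']
      _ ≤ (d / d' : ℝ≥0) * D.weight g n m' d' z := by
          gcongr
          exact le_add_self
  rw [momentFactor, ENNReal.coe_add, add_mul]
  rcases lt_or_ge t n with h | h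
  · refine le_add_right ?_
    rw [ENNReal.coe_inv hm'.ne', mul_comm, ← div_eq_mul_inv, ENNReal.le_div_iff_mul_le
      (.inl (by exact_mod_cast hm'.ne')) (.inl ENNReal.coe_ne_top), mul_comm]
    exact hlt h
  · refine le_add_left ((hge h).trans ?_)
    calc (M : ℝ≥0∞) ^ t * (g z + d * t)
        ≤ (M : ℝ≥0∞) ^ t * (D.weight g n m' d' z +
            (d / d' : ℝ≥0) * D.weight g n m' d' z * t) := by gcongr
      _ = (M ^ t * (1 + d / d' * t) : ℝ≥0) * D.weight g n m' d' z := by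
          push_cast
          ring

theorem Drift.absMoment_c_le (h : D.Drift β g n₀ M d) (hM : 1 ≤ M) (hn : n₀ ≤ n) (hm' : 0 < m')
    (hd' : 0 < d') (t : ℕ) (z : Z) :
    D.absMoment D.c t z ≤ momentFactor M d m' d' t * D.envelope g n m' d' z :=
  (absMoment_le_momentFactor_mul_weight hm' hd' mul_absMoment_c_le_weight fun ht =>
    h.absMoment_le hM D.measurable_c h.flow_le (hn.trans ht) z).trans
      (mul_le_mul_right le_add_self _)

theorem Drift.absMoment_r_le (h : D.Drift β g n₀ M d) (hM : 1 ≤ M) (hn : n₀ ≤ n) (hm' : 0 < m')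
    (hd' : 0 < d') (t : ℕ) (z : Z) :
    D.absMoment D.r t z ≤ momentFactor M d m' d' t * D.envelope g n m' d' z := by
  rcases eq_or_ne t 0 with rfl | h0
  · have one_le_momentFactor : (1 : ℝ≥0∞) ≤ momentFactor M d m' d' 0 := by
      simp [momentFactor]
    rw [D.absMoment_zero D.measurable_r, envelope]
    exact le_self_add.trans (le_mul_of_one_le_left' one_le_momentFactor)
  · exact (absMoment_le_momentFactor_mul_weight hm' hd' (mul_absMoment_r_le_weight h0) fun ht =>
      h.absMoment_le hM D.measurable_r h.exit_le (hn.trans ht) z).trans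
        (mul_le_mul_right le_add_self _)

theorem Drift.totalMoment_le (h : D.Drift β g n₀ M d) (hM : 1 ≤ M) (hn : n₀ ≤ n) (hm' : 0 < m')
    (hd' : 0 < d') (t : ℕ) (z : Z) :
    D.totalMoment t z ≤ (2 * momentFactor M d m' d' t : ℝ≥0) * D.envelope g n m' d' z := by
  rw [two_mul, ENNReal.coe_add, add_mul]
  exact add_le_add (h.absMoment_r_le hM hn hm' hd' t z) (h.absMoment_c_le hM hn hm' hd' t z)

end StoppingProblem

/-! ### Weak convergence and unbounded integrands -/

section WeakConvergence

variable {Ω : Type*} [MeasurableSpace Ω] [TopologicalSpace Ω] [OpensMeasurableSpace Ω]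
  [HasOuterApproxClosed Ω] {μ : ProbabilityMeasure Ω} {μs : ℕ → ProbabilityMeasure Ω}

theorem eventually_lt_integral_of_nonneg (hμ : Tendsto μs atTop (𝓝 μ)) {f : Ω → ℝ}
    (hf : Continuous f) (hf0 : 0 ≤ f) (hi : Integrable f μ) (his : ∀ i, Integrable f (μs i))
    {a : ℝ} (ha : a < ∫ x, f x ∂μ) : ∀ᶠ i in atTop, a < ∫ x, f x ∂(μs i) := by
  rcases lt_or_ge a 0 with h | h
  · exact Eventually.of_forall fun i => h.trans_le (integral_nonneg hf0)
  have fatou := lintegral_le_liminf_lintegral_of_forall_isOpen_measure_le_liminf_measure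
    (μ := (μ : Measure Ω)) (μs := fun i => (μs i : Measure Ω)) hf hf0
    fun G hG => ProbabilityMeasure.le_liminf_measure_open_of_tendsto hμ hG
  rw [← ofReal_integral_eq_lintegral_ofReal hi (Eventually.of_forall hf0)] at fatou
  have ofReal_lt := (ENNReal.ofReal_lt_ofReal_iff (h.trans_lt ha)).2 ha
  filter_upwards [eventually_lt_of_lt_liminf (ofReal_lt.trans_le fatou)] with i hlt
  rw [← ofReal_integral_eq_lintegral_ofReal (his i) (Eventually.of_forall hf0)] at hlt
  exact (ENNReal.ofReal_lt_ofReal_iff_of_nonneg h).1 hlt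

theorem eventually_lt_integral_of_abs_le (hμ : Tendsto μs atTop (𝓝 μ)) {f H : Ω → ℝ}
    (hf : Continuous f) (hH : Continuous H) (hfH : ∀ x, |f x| ≤ H x) (hi : Integrable H μ)
    (his : ∀ i, Integrable H (μs i))
    (hlim : Tendsto (fun i => ∫ x, H x ∂(μs i)) atTop (𝓝 (∫ x, H x ∂μ))) {a : ℝ}
    (ha : a < ∫ x, f x ∂μ) : ∀ᶠ i in atTop, a < ∫ x, f x ∂(μs i) := by
  have integrable_of_dominated {ν : Measure Ω} (hν : Integrable H ν) : Integrable f ν :=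
    hν.mono' hf.measurable.aestronglyMeasurable (Eventually.of_forall hfH)
  have gap : (a + ∫ x, f x ∂μ) / 2 + ∫ x, H x ∂μ < ∫ x, (f x + H x) ∂μ := by
    rw [integral_add (integrable_of_dominated hi) hi]
    linarith
  have eventually_lt_sum := eventually_lt_integral_of_nonneg (f := fun x => f x + H x) hμ
    (hf.add hH) (fun x => neg_le_iff_add_nonneg.1 (neg_le_of_abs_le (hfH x)))
    ((integrable_of_dominated hi).add hi)
    (fun i => (integrable_of_dominated (his i)).add (his i)) gap
  have eventually_H_lt : ∀ᶠ i in atTop, ∫ x, H x ∂(μs i) <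
      ∫ x, H x ∂μ + (∫ x, f x ∂μ - a) / 2 := hlim.eventually_lt_const (by linarith)
  filter_upwards [eventually_lt_sum, eventually_H_lt] with i hsum hHlt
  rw [integral_add (integrable_of_dominated (his i)) (his i)] at hsum
  linarith

theorem tendsto_integral_of_abs_le (hμ : Tendsto μs atTop (𝓝 μ)) {f H : Ω → ℝ}
    (hf : Continuous f) (hH : Continuous H) (hfH : ∀ x, |f x| ≤ H x) (hi : Integrable H μ)
    (his : ∀ i, Integrable H (μs i))
    (hlim : Tendsto (fun i => ∫ x, H x ∂(μs i)) atTop (𝓝 (∫ x, H x ∂μ))) :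
    Tendsto (fun i => ∫ x, f x ∂(μs i)) atTop (𝓝 (∫ x, f x ∂μ)) := by
  refine tendsto_order.2
    ⟨fun a ha => eventually_lt_integral_of_abs_le hμ hf hH hfH hi his hlim ha, fun b hb => ?_⟩
  have eventually_lt_neg := eventually_lt_integral_of_abs_le (f := fun x => -f x) (a := -b) hμ
    hf.neg hH (by simpa only [abs_neg] using hfH) hi his hlim
    (by rwa [integral_neg, neg_lt_neg_iff])
  simpa only [integral_neg, neg_lt_neg_iff] using eventually_lt_neg

end WeakConvergence

namespace FiniteContinuous

variable {A : Type*} [TopologicalSpace A] {f g : A → ℝ≥0∞}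

theorem continuous (hf : FiniteContinuous f) : Continuous f := by
  simpa only [Function.comp_def, ENNReal.ofReal_toReal (hf.1 _)] using
    ENNReal.continuous_ofReal.comp hf.2

theorem enorm {u : A → ℝ} (hu : Continuous u) : FiniteContinuous fun a => ‖u a‖ₑ :=
  ⟨fun _ => enorm_ne_top, by simpa only [toReal_enorm] using hu.norm⟩

theorem add (hf : FiniteContinuous f) (hg : FiniteContinuous g) :
    FiniteContinuous fun a => f a + g a := by
  refine ⟨fun a => ENNReal.add_ne_top.2 ⟨hf.1 a, hg.1 a⟩, ?_⟩
  simp_rw [ENNReal.toReal_add (hf.1 _) (hg.1 _)]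
  exact hf.2.add hg.2

theorem const_mul (hf : FiniteContinuous f) (C : ℝ≥0) : FiniteContinuous fun a => C * f a := by
  refine ⟨fun a => ENNReal.mul_ne_top ENNReal.coe_ne_top (hf.1 a), ?_⟩
  simp_rw [ENNReal.toReal_mul]
  exact hf.2.const_mul _

end FiniteContinuous

section JointLaw

variable {Z Θ : Type*} [MeasurableSpace Z] {D : Θ → StoppingProblem Z}

/-- The law of the next state, as a point of the space of probability measures, in which the
parametric Feller property is a continuity statement. -/
def transitionLaw (D : Θ → StoppingProblem Z) (p : Z × Θ) : ProbabilityMeasure Z :=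
  ⟨(D p.2).P p.1, inferInstance⟩

/-- The joint law of the next state and the (constant) parameter; it turns integrands that depend
on the parameter into fixed ones. -/
def jointLaw [MeasurableSpace Θ] (D : Θ → StoppingProblem Z) (p : Z × Θ) :
    ProbabilityMeasure (Z × Θ) :=
  (transitionLaw D p).prod (diracProba p.2)

theorem coe_jointLaw [MeasurableSpace Θ] (p : Z × Θ) :
    (jointLaw D p : Measure (Z × Θ)) = ((D p.2).P p.1).map fun z => (z, p.2) :=
  Measure.prod_dirac p.2

variable [TopologicalSpace Z] [SecondCountableTopology Z]
  [TopologicalSpace.PseudoMetrizableSpace Z] [OpensMeasurableSpace Z] [TopologicalSpace Θ]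
  [SecondCountableTopology Θ] [TopologicalSpace.PseudoMetrizableSpace Θ]

theorem ParamFeller.continuous_jointLaw [MeasurableSpace Θ] [OpensMeasurableSpace Θ]
    (hD : ParamFeller D) : Continuous (jointLaw D) := by
  have continuous_transitionLaw : Continuous (transitionLaw D) :=
    ProbabilityMeasure.continuous_iff_forall_continuous_integral.2 hD
  exact ProbabilityMeasure.continuous_prod.comp
    (continuous_transitionLaw.prodMk (continuous_diracProba.comp continuous_snd))

theorem ParamFeller.continuous_integral (hD : ParamFeller D) {f : Z × Θ → ℝ} (hf : Continuous f)
    {L : Z × Θ → ℝ≥0∞} (hL : FiniteContinuous L) (hfL : ∀ p, ‖f p‖ₑ ≤ L p)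
    (hPL : FiniteContinuous fun p : Z × Θ => ∫⁻ z', L (z', p.2) ∂((D p.2).P p.1)) :
    Continuous fun p : Z × Θ => ∫ z', f (z', p.2) ∂((D p.2).P p.1) := by
  borelize Θ
  have abs_le (x : Z × Θ) : |f x| ≤ (L x).toReal := by
    rw [← Real.norm_eq_abs, ← toReal_enorm]
    exact ENNReal.toReal_mono (hL.1 x) (hfL x)
  have integral_f (p : Z × Θ) : ∫ x, f x ∂(jointLaw D p : Measure (Z × Θ)) =
      ∫ z', f (z', p.2) ∂((D p.2).P p.1) := by
    rw [coe_jointLaw]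
    exact integral_map (by fun_prop) hf.measurable.aestronglyMeasurable
  have lintegral_L (p : Z × Θ) : ∫⁻ x, L x ∂(jointLaw D p : Measure (Z × Θ)) =
      ∫⁻ z', L (z', p.2) ∂((D p.2).P p.1) := by
    rw [coe_jointLaw]
    exact lintegral_map hL.continuous.measurable (by fun_prop)
  have integrable_L (p : Z × Θ) :
      Integrable (fun x => (L x).toReal) (jointLaw D p : Measure (Z × Θ)) :=
    integrable_toReal_of_lintegral_ne_top hL.continuous.measurable.aemeasurable
      ((lintegral_L p).trans_ne (hPL.1 p))
  have integral_L (p : Z × Θ) : ∫ x, (L x).toReal ∂(jointLaw D p : Measure (Z × Θ)) =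
      (∫⁻ z', L (z', p.2) ∂((D p.2).P p.1)).toReal := by
    rw [integral_toReal hL.continuous.measurable.aemeasurable
      (Eventually.of_forall fun x => (hL.1 x).lt_top), lintegral_L]
  refine continuous_iff_seqContinuous.2 fun u p hu => ?_
  simp only [Function.comp_def, ← integral_f]
  refine tendsto_integral_of_abs_le ((hD.continuous_jointLaw.tendsto p).comp hu) hf hL.2 abs_le
    (integrable_L p) (fun i => integrable_L _) ?_
  simp only [Function.comp_def, integral_L]
  exact (hPL.2.tendsto p).comp hu

end JointLaw

/-! ### Joint continuity of the continuation value -/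

theorem tendstoLocallyUniformly_of_dist_le_mul {ι A E : Type*} [TopologicalSpace A]
    [PseudoMetricSpace E] {l : Filter ι} {F : ι → A → E} {f : A → E} {a : ι → ℝ} {L : A → ℝ}
    (ha0 : ∀ i, 0 ≤ a i) (ha : Tendsto a l (𝓝 0)) (hL : Continuous L)
    (h : ∀ i x, dist (f x) (F i x) ≤ a i * L x) : TendstoLocallyUniformly F f l := by
  refine Metric.tendstoLocallyUniformly_iff.2 fun ε hε x => ?_
  have tendsto_bound : Tendsto (fun i => a i * (L x + 1)) l (𝓝 0) := by
    simpa only [zero_mul] using ha.mul_const (L x + 1)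
  refine ⟨_, hL.continuousAt.eventually_lt_const (lt_add_one (L x)), ?_⟩
  filter_upwards [tendsto_bound.eventually_lt_const hε] with i hi y hy
  exact ((h i y).trans (mul_le_mul_of_nonneg_left hy.le (ha0 i))).trans_lt hi

/-- `L` is a finite continuous function, with finite continuous one-step expectations, which
dominates the moments of the payoffs at all orders, with constants `K t` that are summable after
discounting. -/
structure IsEnvelope {Z Θ : Type*} [MeasurableSpace Z] [TopologicalSpace Z] [TopologicalSpace Θ]
    (D : Θ → StoppingProblem Z) (β : ℝ) (L : Z × Θ → ℝ≥0∞) (K : ℕ → ℝ≥0) : Prop where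
  finiteContinuous : FiniteContinuous L
  finiteContinuous_lintegral :
    FiniteContinuous fun p : Z × Θ => ∫⁻ z', L (z', p.2) ∂((D p.2).P p.1)
  totalMoment_le : ∀ t p, (D p.2).totalMoment t p.1 ≤ K t * L p
  summable : Summable fun t => ‖β‖₊ ^ t * K t

namespace IsEnvelope

variable {Z Θ : Type*} [MeasurableSpace Z] [TopologicalSpace Z] [TopologicalSpace Θ]
  {D : Θ → StoppingProblem Z} {β : ℝ} {L : Z × Θ → ℝ≥0∞} {K : ℕ → ℝ≥0}

theorem enorm_finiteHorizonValue_le (hL : IsEnvelope D β L K) (N : ℕ) (p : Z × Θ) :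
    ‖(D p.2).finiteHorizonValue β N p.1‖ₑ ≤
      (∑ t ∈ Finset.range (N + 1), ‖β‖₊ ^ t * K t : ℝ≥0) * L p := by
  refine ((D p.2).enorm_finiteHorizonValue_le β N p.1).trans ?_
  push_cast
  rw [Finset.sum_mul]
  refine Finset.sum_le_sum fun t _ => ?_
  rw [mul_assoc]
  exact mul_le_mul_right (hL.totalMoment_le t p) _

theorem tailMoment_le (hL : IsEnvelope D β L K) (N : ℕ) (p : Z × Θ) :
    (D p.2).tailMoment β N p.1 ≤ (∑' t, ‖β‖₊ ^ (t + N) * K (t + N) : ℝ≥0) * L p := by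
  rw [ENNReal.coe_tsum (NNReal.summable_nat_add _ hL.summable N), ← ENNReal.tsum_mul_right]
  refine ENNReal.tsum_le_tsum fun t => ?_
  rw [ENNReal.coe_mul, mul_assoc, ENNReal.coe_pow]
  exact mul_le_mul_right (hL.totalMoment_le _ p) _

theorem tailMoment_ne_top (hL : IsEnvelope D β L K) (N : ℕ) (p : Z × Θ) :
    (D p.2).tailMoment β N p.1 ≠ ∞ :=
  ne_top_of_le_ne_top (ENNReal.mul_ne_top ENNReal.coe_ne_top (hL.finiteContinuous.1 p))
    (hL.tailMoment_le N p)

theorem dist_contValue_le (hL : IsEnvelope D β L K) (hβ : 0 < β) (N : ℕ) (p : Z × Θ) :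
    dist ((D p.2).contValue β p.1) ((D p.2).finiteHorizonContValue β N p.1) ≤
      (∑' t, ‖β‖₊ ^ (t + (N + 1)) * K (t + (N + 1)) : ℝ≥0) * (L p).toReal := by
  rw [dist_eq_norm, ← toReal_enorm, ← ENNReal.coe_toReal, ← ENNReal.toReal_mul]
  exact ENNReal.toReal_mono
    (ENNReal.mul_ne_top ENNReal.coe_ne_top (hL.finiteContinuous.1 p))
    ((StoppingProblem.enorm_contValue_sub_le hβ (fun z => hL.tailMoment_ne_top 0 (z, p.2)) N
      p.1).trans (hL.tailMoment_le (N + 1) p))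

theorem tendstoLocallyUniformly_finiteHorizonContValue (hL : IsEnvelope D β L K) (hβ : 0 < β) :
    TendstoLocallyUniformly (fun N (p : Z × Θ) => (D p.2).finiteHorizonContValue β N p.1)
      (fun p => (D p.2).contValue β p.1) atTop := by
  have tendsto_tail : Tendsto
      (fun N => ((∑' t, ‖β‖₊ ^ (t + (N + 1)) * K (t + (N + 1)) : ℝ≥0) : ℝ)) atTop (𝓝 0) :=
    NNReal.tendsto_coe.2
      ((NNReal.tendsto_sum_nat_add fun t => ‖β‖₊ ^ t * K t).comp (tendsto_add_atTop_nat 1))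
  exact tendstoLocallyUniformly_of_dist_le_mul (fun _ => NNReal.coe_nonneg _) tendsto_tail
    hL.finiteContinuous.2 (hL.dist_contValue_le hβ)

variable [SecondCountableTopology Z] [TopologicalSpace.PseudoMetrizableSpace Z]
  [OpensMeasurableSpace Z] [SecondCountableTopology Θ] [TopologicalSpace.PseudoMetrizableSpace Θ]

theorem continuous_finiteHorizonContValue_of_continuous (hL : IsEnvelope D β L K)
    (hD : ParamFeller D) (hc : Continuous fun p : Z × Θ => (D p.2).c p.1) {N : ℕ}
    (hN : Continuous fun p : Z × Θ => (D p.2).finiteHorizonValue β N p.1) :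
    Continuous fun p : Z × Θ => (D p.2).finiteHorizonContValue β N p.1 := by
  refine hc.add (.const_mul (hD.continuous_integral hN (hL.finiteContinuous.const_mul _)
    (hL.enorm_finiteHorizonValue_le N) ?_) β)
  simp_rw [lintegral_const_mul' _ _ ENNReal.coe_ne_top]
  exact hL.finiteContinuous_lintegral.const_mul _

theorem continuous_finiteHorizonValue (hL : IsEnvelope D β L K) (hD : ParamFeller D)
    (hc : Continuous fun p : Z × Θ => (D p.2).c p.1)
    (hr : Continuous fun p : Z × Θ => (D p.2).r p.1) (N : ℕ) :
    Continuous fun p : Z × Θ => (D p.2).finiteHorizonValue β N p.1 := by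
  induction N with
  | zero => exact hr
  | succ N ih => exact hr.max (hL.continuous_finiteHorizonContValue_of_continuous hD hc ih)

theorem continuous_contValue (hL : IsEnvelope D β L K) (hβ : 0 < β) (hD : ParamFeller D)
    (hc : Continuous fun p : Z × Θ => (D p.2).c p.1)
    (hr : Continuous fun p : Z × Θ => (D p.2).r p.1) :
    Continuous fun p : Z × Θ => (D p.2).contValue β p.1 :=
  (hL.tendstoLocallyUniformly_finiteHorizonContValue hβ).continuous <| .of_forall fun N =>
    hL.continuous_finiteHorizonContValue_of_continuous hD hc
      (hL.continuous_finiteHorizonValue hD hc hr N)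

end IsEnvelope

section Parametric

open StoppingProblem

variable {Z Θ : Type*} [MeasurableSpace Z] {D : Θ → StoppingProblem Z} {β : ℝ}
  {g : Θ → Z → ℝ≥0} {n : Θ → ℕ} {m d : Θ → ℝ≥0} {m' d' : ℝ≥0}

theorem StoppingProblem.Drift.mono {D : StoppingProblem Z} {g : Z → ℝ≥0} {n : ℕ}
    {m M d d₁ : ℝ≥0} (h : D.Drift β g n m d) (hm : m ≤ M) (hd : d ≤ d₁) (hβM : β * M < 1) :
    D.Drift β g n M d₁ where
  measurable_g := h.measurable_g
  discount := hβM
  exit_le := h.exit_le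
  flow_le := h.flow_le
  drift z := (h.drift z).trans (by gcongr)

theorem ParamDrift.mul_max_iSup_lt_one (h : ParamDrift D β g n m d) (hβ : β ∈ Set.Ioo (0 : ℝ) 1) :
    β * (max (⨆ θ, m θ) 1 : ℝ≥0) < 1 := by
  rw [NNReal.coe_max, mul_max_of_nonneg _ _ hβ.1.le, NNReal.coe_one, mul_one]
  exact max_lt h.discount hβ.2

theorem ParamDrift.totalMoment_le (h : ParamDrift D β g n m d) (hβ : β ∈ Set.Ioo (0 : ℝ) 1)
    (hm' : 0 < m') (hd' : 0 < d') (t : ℕ) (p : Z × Θ) :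
    (D p.2).totalMoment t p.1 ≤
      (2 * momentFactor (max (⨆ θ, m θ) 1) (⨆ θ, d θ) m' d' t : ℝ≥0) *
        (D p.2).envelope (g p.2) (⨆ θ, n θ) m' d' p.1 :=
  ((h.drift p.2).mono ((le_ciSup h.bdd_m p.2).trans (le_max_left _ 1)) (le_ciSup h.bdd_d p.2)
    (h.mul_max_iSup_lt_one hβ)).totalMoment_le (le_max_right _ _) (le_ciSup h.bdd_n p.2) hm' hd' t
      p.1

theorem ParamCont.finiteContinuous_lintegral_envelope [TopologicalSpace Z] [TopologicalSpace Θ]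
    (h : ParamCont D g n m' d') : FiniteContinuous fun p : Z × Θ =>
      ∫⁻ z', (D p.2).envelope (g p.2) (⨆ θ, n θ) m' d' z' ∂((D p.2).P p.1) := by
  have lintegral_envelope (p : Z × Θ) :
      ∫⁻ z', (D p.2).envelope (g p.2) (⨆ θ, n θ) m' d' z' ∂((D p.2).P p.1) =
        ∫⁻ z', ENNReal.ofReal |(D p.2).r z'| ∂((D p.2).P p.1) +
          ∫⁻ z', paramWeight D g n m' d' z' p.2 ∂((D p.2).P p.1) := by
    simp only [← Real.enorm_eq_ofReal_abs]
    exact lintegral_add_left (D p.2).measurable_r.enorm _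
  simpa only [lintegral_envelope] using h.cont_int_r.add h.cont_int_weight

theorem ParamDrift.isEnvelope [TopologicalSpace Z] [TopologicalSpace Θ]
    (h : ParamDrift D β g n m d) (hβ : β ∈ Set.Ioo (0 : ℝ) 1) (hm' : 0 < m') (hd' : 0 < d')
    (hcont : ParamCont D g n m' d') :
    IsEnvelope D β (fun p => (D p.2).envelope (g p.2) (⨆ θ, n θ) m' d' p.1)
      fun t => 2 * momentFactor (max (⨆ θ, m θ) 1) (⨆ θ, d θ) m' d' t where
  finiteContinuous := (FiniteContinuous.enorm hcont.cont_r).add hcont.cont_weight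
  finiteContinuous_lintegral := hcont.finiteContinuous_lintegral_envelope
  totalMoment_le := h.totalMoment_le hβ hm' hd'
  summable := by
    have nnnorm_β : (‖β‖₊ : ℝ) = β := abs_of_pos hβ.1
    have nnnorm_β_mul_lt : ‖β‖₊ * max (⨆ θ, m θ) 1 < 1 := by
      rw [← NNReal.coe_lt_coe, NNReal.coe_mul, nnnorm_β]
      exact h.mul_max_iSup_lt_one hβ
    have nnnorm_β_lt : ‖β‖₊ < 1 := by
      rw [← NNReal.coe_lt_coe, nnnorm_β]
      exact hβ.2
    exact ((summable_momentFactor nnnorm_β_lt nnnorm_β_mul_lt _ m' d').mul_left 2).congr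
      fun t => mul_left_comm _ _ _

end Parametric

/-! ### Thresholds -/

theorem lt_and_lt_or_lt_and_lt_of_mul_sub_pos {X : Type*} [LinearOrder X] {f : X → ℝ}
    (hf : StrictMono f ∨ StrictAnti f) {a b x : X} (h : 0 < (f b - f a) * (f x - f a)) :
    a < b ∧ a < x ∨ b < a ∧ x < a := by
  simp only [mul_pos_iff, sub_pos, sub_neg] at h
  rcases hf with hf | hf
  · simpa only [hf.lt_iff_lt] using h
  · simpa only [hf.lt_iff_gt, or_comm] using h

theorem continuous_of_strictMono_or_strictAnti {X A : Type*} [LinearOrder X] [TopologicalSpace X]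
    [OrderTopology X] [TopologicalSpace A] {f : X → A → ℝ} {u : A → ℝ} {x : A → X}
    (hf : ∀ a, Continuous (f a)) (hu : Continuous u)
    (hmono : ∀ p, StrictMono (fun a => f a p) ∨ StrictAnti fun a => f a p)
    (hx : ∀ p, f (x p) p = u p) : Continuous x := by
  refine continuous_iff_continuousAt.2 fun p => ?_
  have eventually_pos {a : X} (ha : a ≠ x p) :
      ∀ᶠ q in 𝓝 p, 0 < (f (x p) q - f a q) * (f (x q) q - f a q) := by
    have continuous_mul : Continuous fun q => (f (x p) q - f a q) * (u q - f a q) := by fun_prop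
    have ne : f (x p) p - f a p ≠ 0 :=
      sub_ne_zero.2 (((hmono p).elim StrictMono.injective StrictAnti.injective).ne ha.symm)
    simp_rw [hx]
    refine (continuous_mul.tendsto p).eventually_const_lt ?_
    rw [← hx]
    exact mul_self_pos.2 ne
  have eventually_same_side {a : X} (ha : a ≠ x p) :
      ∀ᶠ q in 𝓝 p, a < x p ∧ a < x q ∨ x p < a ∧ x q < a :=
    (eventually_pos ha).mono fun q => lt_and_lt_or_lt_and_lt_of_mul_sub_pos (hmono q)
  refine tendsto_order.2 ⟨fun a ha => (eventually_same_side ha.ne).mono fun q hq => ?_,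
    fun a ha => (eventually_same_side ha.ne').mono fun q hq => ?_⟩
  · exact hq.elim And.right fun hlt => absurd hlt.1 ha.asymm
  · exact hq.elim (fun hlt => absurd hlt.1 ha.asymm) And.right

namespace ThresholdProblem

variable {X Y : Type*} [MeasurableSpace X] [MeasurableSpace Y]

theorem HasReservation.strictMono_or_strictAnti [Preorder X] {T : ThresholdProblem X Y} {β : ℝ}
    (h : T.HasReservation β) (y : Y) :
    StrictMono (fun x => T.r (x, y)) ∨ StrictAnti fun x => T.r (x, y) :=
  h.strict.imp (fun h => h y) fun h => h y

theorem HasReservation.existsUnique_isDecisionThreshold [LinearOrder X] {T : ThresholdProblem X Y}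
    {β : ℝ} (h : T.HasReservation β) : ∃! xbar : Y → X, T.IsDecisionThreshold β xbar := by
  choose xbar hxbar using h.exists_indifferent
  refine ⟨xbar, hxbar, fun xbar' hxbar' => funext fun y => ?_⟩
  exact (h.strictMono_or_strictAnti y).elim StrictMono.injective StrictAnti.injective
    ((hxbar' y).trans (hxbar y).symm)

theorem continuous_contValue {Θ : Type*} [TopologicalSpace X] [TopologicalSpace Y]
    [TopologicalSpace Θ] {T : Θ → ThresholdProblem X Y} {β : ℝ}
    (h : Continuous fun p : (X × Y) × Θ => (T p.2).toStopping.contValue β p.1) (x : X) :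
    Continuous fun p : Y × Θ => (T p.2).contValue β p.1 :=
  h.comp (f := fun p : Y × Θ => ((x, p.1), p.2)) (by fun_prop)

theorem continuous_isDecisionThreshold {Θ : Type*} [LinearOrder X] [TopologicalSpace X]
    [OrderTopology X] [TopologicalSpace Y] [TopologicalSpace Θ] {T : Θ → ThresholdProblem X Y}
    {β : ℝ} (hres : ∀ θ, (T θ).HasReservation β)
    (hr : Continuous fun p : (X × Y) × Θ => (T p.2).r p.1)
    (hψ : Continuous fun p : (X × Y) × Θ => (T p.2).toStopping.contValue β p.1)
    {xbar : Θ → Y → X} (hxbar : ∀ θ, (T θ).IsDecisionThreshold β (xbar θ)) :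
    Continuous fun p : Y × Θ => xbar p.2 p.1 := by
  rcases isEmpty_or_nonempty X with _ | ⟨⟨x₀⟩⟩
  · have : IsEmpty (Y × Θ) := ⟨fun p => IsEmpty.false (xbar p.2 p.1)⟩
    exact continuous_of_discreteTopology
  · exact continuous_of_strictMono_or_strictAnti (f := fun x (p : Y × Θ) => (T p.2).r (x, p.1))
      (fun x => hr.comp (f := fun p : Y × Θ => ((x, p.1), p.2)) (by fun_prop))
      (continuous_contValue hψ x₀) (fun p => (hres p.2).strictMono_or_strictAnti p.1)
      fun p => hxbar p.2 p.1

end ThresholdProblem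

theorem mainTheorem9_general {X Y Θ : Type*}
    [LinearOrder X] [TopologicalSpace X] [OrderTopology X] [SecondCountableTopology X]
    [MeasurableSpace X] [OpensMeasurableSpace X]
    [TopologicalSpace Y] [SecondCountableTopology Y] [TopologicalSpace.PseudoMetrizableSpace Y]
    [MeasurableSpace Y] [OpensMeasurableSpace Y]
    [TopologicalSpace Θ] [SecondCountableTopology Θ] [TopologicalSpace.PseudoMetrizableSpace Θ]
    {β : ℝ} (hβ : β ∈ Set.Ioo (0 : ℝ) 1) {T : Θ → ThresholdProblem X Y}
    {g : Θ → (X × Y) → ℝ≥0} {n : Θ → ℕ} {m d : Θ → ℝ≥0} {m' d' : ℝ≥0}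
    (hdrift : ParamDrift (fun θ => (T θ).toStopping) β g n m d) (hm' : 0 < m') (hd' : 0 < d')
    (hfeller : ParamFeller fun θ => (T θ).toStopping)
    (hcont : ParamCont (fun θ => (T θ).toStopping) g n m' d')
    (hres : ∀ θ, (T θ).HasReservation β) :
    (∃! xbar : Θ → Y → X, ∀ θ, (T θ).IsDecisionThreshold β (xbar θ)) ∧
    ∀ xbar : Θ → Y → X, (∀ θ, (T θ).IsDecisionThreshold β (xbar θ)) →
      Continuous fun p : Y × Θ => xbar p.2 p.1 := by
  have continuous_ψ := (hdrift.isEnvelope hβ hm' hd' hcont).continuous_contValue hβ.1 hfeller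
    hcont.cont_c hcont.cont_r
  choose xbar hxbar xbar_unique using fun θ => (hres θ).existsUnique_isDecisionThreshold
  exact ⟨⟨xbar, hxbar, fun xbar' hxbar' => funext fun θ => xbar_unique θ _ (hxbar' θ)⟩,
    fun _ => ThresholdProblem.continuous_isDecisionThreshold hres hcont.cont_r continuous_ψ⟩

end

theorem mainTheorem9 {q k : ℕ}
    (X : Set ℝ) (hX : Convex ℝ X)
    (Y : Set (EuclideanSpace ℝ (Fin q))) (hY : Convex ℝ Y)
    (Θ : Set (EuclideanSpace ℝ (Fin k)))
    (β : ℝ) (hβ : β ∈ Set.Ioo (0 : ℝ) 1)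
    (T : Θ → ThresholdProblem X Y)
    (g : Θ → (X × Y) → ℝ≥0) (n : Θ → ℕ) (m d : Θ → ℝ≥0) (m' d' : ℝ≥0)
    (hdrift : ParamDrift (fun θ => (T θ).toStopping) β g n m d)
    (hconst : WeightConstants β (⨆ θ, m θ) (⨆ θ, d θ) m' d')
    (hfeller : ParamFeller fun θ => (T θ).toStopping)
    (hcont : ParamCont (fun θ => (T θ).toStopping) g n m' d')
    (hres : ∀ θ, (T θ).HasReservation β) :
    (∃! xbar : Θ → Y → X, ∀ θ, (T θ).IsDecisionThreshold β (xbar θ)) ∧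
    ∀ xbar : Θ → Y → X, (∀ θ, (T θ).IsDecisionThreshold β (xbar θ)) →
      Continuous fun p : Y × Θ => xbar p.2 p.1 := by
  have := hX.ordConnected
  exact mainTheorem9_general hβ hdrift hconst.pos_m' hconst.pos_d' hfeller hcont hres
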